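/- Let $n\ge 3$ and let $K$ be a field of characteristic $0$ (for example $K=\overline{\mathbf Q}_\ell$). Put $G=\mathrm{GL}_n$, $R=K[x_1,\dots,x_n]$ with each $x_i$ in degree $2$, let $W=S_n$ permute the variables, and let $R^W\cong H^*(\mathbb{B}G)$ be the ring of symmetric polynomials with augmentation ideal $R^W_+$. The Gross motive of $G$ is the graded vector space $\mathbb V=R^W_+/(R^W_+)^2=\bigoplus_d \mathbb V_{2d}$. Let $\mu=(1,1,0,\dots,0)$, $W_\mu=S_2\times S_{n-2}$, $\partial_\mu=\partial_{x_1}+\partial_{x_2}$, and $\eta=(x_1+x_2)^{2n-3}\in R^{W_\mu}\cong H^*(\mathbb{B}P_\mu)$. Here $G/P_\mu$ is the Grassmannian of planes in an $n$-dimensional space, $D_\mu=\dim G/P_\mu=2(n-2)$, and $x_1,x_2$ are the Chern roots of the tautological rank-two subbundle. Let $\int_{G/P_\mu}:R^{W_\mu}\to R^W$ be push-forward along $\mathbb{B}P_\mu\to \mathbb{B}G$, i.e. the unique $R^W$-linear map which lowers degrees by $2D_\mu$ and sends $(x_1x_2)^{n-2}$ (the class of a point on the fibre $G/P_\mu$)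 to $1$. Let $\nabla^\eta_\mu:R^W\to R^W$ be the derivation $f\mapsto\int_{G/P_\mu}\eta\cdot\partial_\mu f$, and let $\overline\nabla^\eta_\mu$ be the graded endomorphism of $\mathbb V$ that it induces. Then the push-forward map exists and is unique as described, $\mathbb V=\bigoplus_{i=1}^n\mathbb V_{2i}$ with each $\mathbb V_{2i}$ ($1\le i\le n$) one-dimensional, and $\overline\nabla^\eta_\mu$ acts on $\mathbb V_{2i}$ as multiplication by the eigenweight $$\epsilon_i(\eta,\mu)=\frac1n\binom{2n-2}{n-1}-\binom{2n-3}{n-i}+2\binom{2n-3}{n-i-1}-\binom{2n-3}{n-i-2},\qquad 1\le i\le n,$$ where $\binom{m}{k}=0$ for $k<0$. -/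

import Mathlib

open MvPolynomial

noncomputable section

namespace GLEigenweight

variable {n : ℕ} (K : Type*) [Field K]

/-- `R^W` for `GL_n`: here `R = K[x_1, …, x_n]` is the (equivariant) cohomology of a point for the
diagonal torus, each `x_i` having cohomological degree `2`, i.e. polynomial degree `1`; the Weyl
group `W = S_n` permutes the variables, and `R^W = H^*(BGL_n)`. -/
abbrev RW (n : ℕ) : Subalgebra K (MvPolynomial (Fin n) K) := symmetricSubalgebra (Fin n) K

/-- `R^{W_μ} = H^*(BP_μ)` for a coweight `μ ∈ ℤ^n`, as an `R^W`-subalgebra of `R`. Here `W_μ` is the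
stabilizer of `μ` in `S_n`. -/
def RWμ (μ : Fin n → ℤ) : Subalgebra (RW K n) (MvPolynomial (Fin n) K) where
  carrier := {f | ∀ w : Equiv.Perm (Fin n), (∀ i, μ (w i) = μ i) → rename w f = f}
  algebraMap_mem' r w _ := r.2 w
  mul_mem' ha hb w hw := by rw [map_mul, ha w hw, hb w hw]
  add_mem' ha hb w hw := by rw [map_add, ha w hw, hb w hw]

set_option synthInstance.maxHeartbeats 200000 in
instance (μ : Fin n → ℤ) : Algebra (RW K n) (RWμ K μ) := inferInstance

instance (μ : Fin n → ℤ) : Module (RW K n) (RWμ K μ) := Algebra.toModule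

instance (μ : Fin n → ℤ) : SMul (RW K n) (RWμ K μ) := Algebra.toSMul

instance : Module (RW K n) (RW K n) := Semiring.toModule

set_option synthInstance.maxHeartbeats 200000 in
instance (μ : Fin n → ℤ) : IsScalarTower K (RW K n) (RWμ K μ) := inferInstance

set_option synthInstance.maxHeartbeats 200000 in
instance (I : Ideal (RW K n)) : Module (RW K n) I := inferInstance

variable {K}

/-- `D_μ = dim G/P_μ`: the number of roots `x_i - x_j` with `⟨x_i - x_j, μ⟩ < 0`. -/
def flagDim (μ : Fin n → ℤ) : ℕ :=
  (Finset.univ.filter fun p : Fin n × Fin n => μ p.1 < μ p.2).card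

/-- The derivation `∂_μ = ∑ μ_i ∂/∂x_i` of `R`. -/
def pderivCoweight (μ : Fin n → ℤ) :
    Derivation K (MvPolynomial (Fin n) K) (MvPolynomial (Fin n) K) :=
  mkDerivation K fun i => C (μ i : K)

theorem rename_pderivCoweight (μ : Fin n → ℤ) (w : Equiv.Perm (Fin n)) (hw : ∀ i, μ (w i) = μ i)
    (f : MvPolynomial (Fin n) K) :
    rename w (pderivCoweight μ f) = pderivCoweight μ (rename w f) := by
  induction f using MvPolynomial.induction_on with
  | C a => simp [pderivCoweight]
  | add p q hp hq => simp [hp, hq]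
  | mul_X p i hp =>
    have hX : ∀ j, pderivCoweight (K := K) μ (X j) = C (μ j : K) := fun j => by
      simp [pderivCoweight]
    simp only [Derivation.leibniz, map_add, map_mul, smul_eq_mul, rename_X, hX, hp, rename_C, hw]

/-- `∂_μ` as a `K`-linear map `R^W → R^{W_μ}`. -/
def pderivLin (μ : Fin n → ℤ) : RW K n →ₗ[K] RWμ K μ where
  toFun f := ⟨pderivCoweight μ f.1, fun w hw => by rw [rename_pderivCoweight μ w hw, f.2 w]⟩
  map_add' f g := Subtype.ext (map_add (pderivCoweight μ) f.1 g.1)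
  map_smul' c f := Subtype.ext ((pderivCoweight μ).map_smul c f.1)

/-- `∂_μ` as a derivation `R^W → R^{W_μ}`. -/
def pderivRW (μ : Fin n → ℤ) : Derivation K (RW K n) (RWμ K μ) :=
  { pderivLin μ with
    map_one_eq_zero' := Subtype.ext (pderivCoweight (K := K) μ).map_one_eq_zero
    leibniz' := fun f g => Subtype.ext ((pderivCoweight μ).leibniz f.1 g.1) }

variable (K) in
/-- The class `∏_i (-x_i)^{#{j : μ_j < μ_i}} ∈ R^{W_μ}`. It restricts to the class of a point on the
fibre `G/P_μ` of `BP_μ → BG`. With `x_i` the Chern roots of the graded pieces of the tautological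
flag, it is a product of top Chern classes of bundles `Hom(gr_a, 𝒪)^{⊕ N_a}`, and sections of these
cut out one reduced point of `G/P_μ`.
For `μ = (1, 0, …, 0)` this is `c_1(𝒪(1))^{n-1}` on `ℙ^{n-1}`, and for `μ = (1, 1, 0, …, 0)` it
is `c_2(S^∨)^{n-2} = (x_1 x_2)^{n-2}` on the Grassmannian of planes with tautological bundle `S`. -/
def pointClass (μ : Fin n → ℤ) : RWμ K μ :=
  ⟨∏ i, (-X i) ^ (Finset.univ.filter fun j => μ j < μ i).card, fun w hw => by
    rw [map_prod]
    refine Fintype.prod_equiv w _ _ fun i => ?_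
    rw [map_pow, map_neg, rename_X, hw]⟩

/-- The characterization of pushforward (fibre integration) along the smooth proper map
`BP_μ → BG` with fibre `G/P_μ`: an `R^W`-linear map `R^{W_μ} → R^W` (projection formula), lowering
the degree by `D_μ = dim G/P_μ` (the cohomological degree by `2 D_μ`), and sending the class of a
point of the fibre to `1`. -/
structure IsFibreIntegral (μ : Fin n → ℤ) (I : RWμ K μ →ₗ[RW K n] RW K n) : Prop where
  eq_zero_of_lt : ∀ (m : ℕ) (f : RWμ K μ), f.1.IsHomogeneous m → m < flagDim μ → I f = 0
  isHomogeneous : ∀ (m : ℕ) (f : RWμ K μ), f.1.IsHomogeneous (m + flagDim μ) →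
    (I f).1.IsHomogeneous m
  point : I (pointClass K μ) = 1

open Classical in
/-- `∫_{G/P_μ} : R^{W_μ} → R^W`, the unique fibre integral (and `0` should there be none). -/
def fibreIntegral (μ : Fin n → ℤ) : RWμ K μ →ₗ[RW K n] RW K n :=
  if h : ∃! I : RWμ K μ →ₗ[RW K n] RW K n, IsFibreIntegral μ I then h.choose else 0

/-- The derivation `∇^η_μ : R^W → R^W`, `f ↦ ∫_{G/P_μ} η · ∂_μ f`. -/
def nabla (μ : Fin n → ℤ) (η : RWμ K μ) : Derivation K (RW K n) (RW K n) :=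
  ((fibreIntegral μ).comp (LinearMap.mulLeft (RW K n) η)).compDer (pderivRW μ)

theorem nabla_apply (μ : Fin n → ℤ) (η : RWμ K μ) (f : RW K n) :
    nabla μ η f = fibreIntegral μ (η * pderivRW μ f) := rfl

variable (K) in
/-- The augmentation ideal `R^W_+` of `R^W`. -/
def augIdeal (n : ℕ) : Ideal (RW K n) :=
  RingHom.ker ((constantCoeff : MvPolynomial (Fin n) K →+* K).comp (RW K n).val.toRingHom)

theorem mem_augIdeal (f : RW K n) : f ∈ augIdeal K n ↔ constantCoeff f.1 = 0 := Iff.rfl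

variable (K) in
/-- The (realization of the) Gross motive `𝕍 = R^W_+ / (R^W_+)^2` of `GL_n`. -/
abbrev GrossMotive (n : ℕ) : Type _ := (augIdeal K n).Cotangent

variable (K) in
/-- The graded piece `𝕍_{2d}`: classes of elements of `R^W_+` that are homogeneous of polynomial
degree `d` in the `x_i`. -/
def grossPiece (n d : ℕ) : Submodule K (GrossMotive K n) :=
  Submodule.map ((augIdeal K n).toCotangent.restrictScalars K)
    (Submodule.comap ((RW K n).val.toLinearMap ∘ₗ ((augIdeal K n).subtype.restrictScalars K))
      (homogeneousSubmodule (Fin n) K d))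

theorem fibreIntegral_constantCoeff (μ : Fin n → ℤ) (m : ℕ) (f : RWμ K μ)
    (hf : f.1.IsHomogeneous m) (hm : m ≠ flagDim μ) :
    constantCoeff (fibreIntegral μ f).1 = 0 := by
  by_cases h : ∃! I : RWμ K μ →ₗ[RW K n] RW K n, IsFibreIntegral μ I
  · have hI : IsFibreIntegral μ (fibreIntegral (K := K) μ) := by
      rw [fibreIntegral, dif_pos h]
      exact h.choose_spec.1
    rcases lt_or_gt_of_ne hm with hlt | hgt
    · rw [hI.eq_zero_of_lt m f hf hlt]; simp
    · obtain ⟨k, rfl⟩ := Nat.exists_eq_add_of_lt hgt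
      have := hI.isHomogeneous (k + 1) f (by convert hf using 1; omega)
      rw [constantCoeff_eq]
      exact this.coeff_eq_zero (by simp)
  · rw [fibreIntegral, dif_neg h]; simp

/-- `∇^η_μ` takes values in `R^W_+` if `η` has degree `2 (D_μ + 1)`. -/
theorem nabla_mem_augIdeal (μ : Fin n → ℤ) (η : RWμ K μ) (hη : η.1.IsHomogeneous (flagDim μ + 1))
    (f : RW K n) : nabla μ η f ∈ augIdeal K n := by
  set g : RWμ K μ := pderivRW μ f with hg
  have hcomp : ∀ m : ℕ, homogeneousComponent m g.1 ∈ RWμ K μ := fun m w hw => by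
    rw [rename_homogeneousComponent, g.2 w hw]
  have hsum : g = ∑ m ∈ Finset.range (g.1.totalDegree + 1),
      (⟨homogeneousComponent m g.1, hcomp m⟩ : RWμ K μ) := by
    apply Subtype.ext
    rw [AddSubmonoidClass.coe_finsetSum]
    exact (sum_homogeneousComponent g.1).symm
  rw [nabla_apply, ← hg, hsum, Finset.mul_sum, map_sum]
  refine Ideal.sum_mem _ fun m _ => ?_
  exact fibreIntegral_constantCoeff μ (flagDim μ + 1 + m) _
    (hη.mul (homogeneousComponent_isHomogeneous m g.1)) (by omega)

/-- The endomorphism `∇̄^η_μ` of the Gross motive induced by `∇^η_μ`, for `η` of degree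
`2 (D_μ + 1)`. -/
def nablaBar (μ : Fin n → ℤ) (η : RWμ K μ) (hη : η.1.IsHomogeneous (flagDim μ + 1)) :
    GrossMotive K n →ₗ[K] GrossMotive K n :=
  Ideal.Cotangent.lift
    (((augIdeal K n).toCotangent.restrictScalars K) ∘ₗ
      (LinearMap.codRestrict ((augIdeal K n).restrictScalars K)
        ((nabla μ η : RW K n →ₗ[K] RW K n) ∘ₗ ((augIdeal K n).subtype.restrictScalars K))
        (fun f => nabla_mem_augIdeal μ η hη f.1)))
    (fun f g => by
      refine (Ideal.toCotangent_eq_zero _ _).2 ?_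
      change nabla μ η (f.1 * g.1) ∈ _
      rw [Derivation.leibniz, pow_two]
      exact Ideal.add_mem _ (Ideal.mul_mem_mul f.2 (nabla_mem_augIdeal μ η hη _))
        (Ideal.mul_mem_mul g.2 (nabla_mem_augIdeal μ η hη _)))

theorem nablaBar_toCotangent (μ : Fin n → ℤ) (η : RWμ K μ)
    (hη : η.1.IsHomogeneous (flagDim μ + 1)) (f : augIdeal K n) :
    nablaBar μ η hη ((augIdeal K n).toCotangent f) =
      (augIdeal K n).toCotangent ⟨nabla μ η f.1, nabla_mem_augIdeal μ η hη f.1⟩ := rfl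

/-- The coweight `(1, 1, 0, …, 0)` of `GL_n`. -/
def coweightTwo (n : ℕ) : Fin n → ℤ := fun i => if (i : ℕ) < 2 then 1 else 0

theorem perm_coweightTwo (n : ℕ) (hn : 3 ≤ n) (w : Equiv.Perm (Fin n))
    (hw : ∀ i, coweightTwo n (w i) = coweightTwo n i) :
    (w ⟨0, by omega⟩ = ⟨0, by omega⟩ ∧ w ⟨1, by omega⟩ = ⟨1, by omega⟩) ∨
      (w ⟨0, by omega⟩ = ⟨1, by omega⟩ ∧ w ⟨1, by omega⟩ = ⟨0, by omega⟩) := by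
  have key : ∀ i : Fin n, (i : ℕ) < 2 → (w i : ℕ) < 2 := fun i hi => by
    by_contra h
    have := hw i
    rw [coweightTwo, coweightTwo, if_neg h, if_pos hi] at this
    exact zero_ne_one this
  have h0 := key ⟨0, by omega⟩ (by simp)
  have h1 := key ⟨1, by omega⟩ (by simp)
  have hne : (w ⟨0, by omega⟩ : ℕ) ≠ w ⟨1, by omega⟩ := fun h => by
    have := w.injective (Fin.ext h)
    simp at this
  simp only [Fin.ext_iff]
  omega

variable (K) in
/-- The polynomial `(x_1 + x_2)^{2n-3}`. -/
def etaPoly (n : ℕ) (hn : 3 ≤ n) : MvPolynomial (Fin n) K :=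
  (X ⟨0, by omega⟩ + X ⟨1, by omega⟩) ^ (2 * n - 3)

theorem etaPoly_mem (n : ℕ) (hn : 3 ≤ n) : etaPoly K n hn ∈ RWμ K (coweightTwo n) := by
  intro w hw
  have h := perm_coweightTwo n hn w hw
  unfold etaPoly
  generalize (⟨0, by omega⟩ : Fin n) = a at *
  generalize (⟨1, by omega⟩ : Fin n) = b at *
  rw [map_pow, map_add, rename_X, rename_X]
  rcases h with ⟨h0, h1⟩ | ⟨h0, h1⟩
  · rw [h0, h1]
  · rw [h0, h1, add_comm]

variable (K) in
/-- The class `η = (x_1 + x_2)^{2n-3}` in `R^{W_μ}`, `μ = (1, 1, 0, …, 0)`. -/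
def etaTwo (n : ℕ) (hn : 3 ≤ n) : RWμ K (coweightTwo n) :=
  ⟨etaPoly K n hn, etaPoly_mem n hn⟩

theorem flagDim_coweightTwo (n : ℕ) (hn : 3 ≤ n) : flagDim (coweightTwo n) + 1 = 2 * n - 3 := by
  obtain ⟨k, rfl⟩ := Nat.exists_eq_add_of_le' (show 2 ≤ n by omega)
  have hset : (Finset.univ.filter fun p : Fin (k + 2) × Fin (k + 2) =>
      coweightTwo (k + 2) p.1 < coweightTwo (k + 2) p.2) =
      (Finset.univ.filter fun i : Fin (k + 2) => ¬ (i : ℕ) < 2) ×ˢ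
        (Finset.univ.filter fun i : Fin (k + 2) => (i : ℕ) < 2) := by
    ext ⟨i, j⟩
    have h : coweightTwo (k + 2) i < coweightTwo (k + 2) j ↔ ¬ (i : ℕ) < 2 ∧ (j : ℕ) < 2 := by
      unfold coweightTwo
      split_ifs with hi hj hj <;> simp [hi, hj]
    simpa only [Finset.mem_filter, Finset.mem_univ, true_and, Finset.mem_product] using h
  have h2 : (Finset.univ.filter fun i : Fin (k + 2) => (i : ℕ) < 2).card = 2 := by
    rw [Fin.card_filter_val_lt]; omega
  have hk : (Finset.univ.filter fun i : Fin (k + 2) => ¬ (i : ℕ) < 2).card = k := by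
    have := Finset.card_filter_add_card_filter_not (s := (Finset.univ : Finset (Fin (k + 2))))
      (fun i : Fin (k + 2) => (i : ℕ) < 2)
    rw [h2, Finset.card_univ, Fintype.card_fin] at this
    omega
  rw [flagDim, hset, Finset.card_product, h2, hk]
  omega

theorem etaTwo_isHomogeneous (n : ℕ) (hn : 3 ≤ n) :
    (etaTwo K n hn).1.IsHomogeneous (flagDim (coweightTwo n) + 1) := by
  rw [flagDim_coweightTwo n hn]
  have := ((isHomogeneous_X K (⟨0, by omega⟩ : Fin n)).add
    (isHomogeneous_X K (⟨1, by omega⟩ : Fin n))).pow (2 * n - 3)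
  rwa [one_mul] at this

/-- The binomial coefficient `C(m, k)` for `k ∈ ℤ`, which is `0` for `k < 0`. -/
def binom (m : ℕ) (k : ℤ) : ℚ := if 0 ≤ k then (m.choose k.toNat : ℚ) else 0

/-- The rational number
`(1/n) C(2n-2, n-1) - C(2n-3, n-i) + 2 C(2n-3, n-i-1) - C(2n-3, n-i-2)`. -/
def eigenweightTwo (n i : ℕ) : ℚ :=
  1 / n * binom (2 * n - 2) (n - 1) - binom (2 * n - 3) (n - i)
    + 2 * binom (2 * n - 3) (n - i - 1) - binom (2 * n - 3) (n - i - 2)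

end GLEigenweight

end

open GLEigenweight

open Finset.HasAntidiagonal (antidiagonal)

/-!
The fibre integral is computed on the quotients
`s(a, b) = (x_1^a x_2^b - x_2^a x_1^b) / (x_1 - x_2)`. They span `R^{W_μ}` over `R^W`: a polynomial
`f` invariant under `S_{n-2}` lies in `R^W[x_1, x_2]`, and if `f` is also symmetric in `x_1, x_2`,
then it is the divided difference of `x_1 f`. Since `∏_i (t - x_i)` vanishes at `t = x_1` and at
`t = x_2`, the sequence `a ↦ s(a, b)` satisfies a linear recurrence of order `n` over `R^W`. A fibre
integral preserves it, and for `a, b < n` the degree and the point class determine its values, so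
`∫ s(a, b) = H(a) H(b + 1) - H(b) H(a + 1)`, where `H(m) = h_{m - n + 1}`. This proves uniqueness;
existence comes from the quotient of alternants
`f ↦ A(f · x_1 · x_3^{n-3} ⋯ x_n^0) / A(x_1^{n-1} ⋯ x_n^0)`.

The Gross motive has the classes of `e_1, …, e_n` as a basis, and
`∂_μ e_{d + 1} = ∑_j (-1)^j e_{d - j} (x_1^j + x_2^j)`. Modulo decomposables only `j = d` survives
after integration. Expanding `η = (x_1 + x_2)^{2n-3}` binomially turns `∫ η (x_1^d + x_2^d)` into a
sum of products `H(a) H(b)` with `a + b = 2n - 1 + d`. Such a product is decomposable unless `a` or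
`b` is `n - 1`, where it is `H(n + d) = h_{d + 1} ≡ (-1)^d e_{d + 1}`, and counting these terms
gives the eigenweight.
-/

noncomputable section

namespace GLEigenweight

variable {K : Type*} [Field K] {n : ℕ}

section Alternant

variable {σ R : Type*} [CommRing R]

theorem X_sub_X_dvd_sub_rename_swap [DecidableEq σ] (i j : σ) (f : MvPolynomial σ R) :
    X i - X j ∣ f - rename (Equiv.swap i j) f := by
  rw [← Ideal.mem_span_singleton, ← Ideal.Quotient.eq]
  set I : Ideal (MvPolynomial σ R) := Ideal.span {X i - X j}
  have mk_X : Ideal.Quotient.mk I (X i) = Ideal.Quotient.mk I (X j) :=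
    Ideal.Quotient.eq.2 (Ideal.mem_span_singleton_self _)
  suffices h : Ideal.Quotient.mkₐ R I =
      (Ideal.Quotient.mkₐ R I).comp (rename (Equiv.swap i j)) from DFunLike.congr_fun h f
  refine MvPolynomial.algHom_ext fun k => ?_
  rw [AlgHom.comp_apply, rename_X, Equiv.swap_apply_def]
  split_ifs with hi hj
  · exact hi ▸ mk_X
  · exact hj ▸ mk_X.symm
  · rfl

theorem X_sub_X_ne_zero [Nontrivial R] {i j : σ} (h : i ≠ j) :
    (X i - X j : MvPolynomial σ R) ≠ 0 :=
  sub_ne_zero.2 (X_injective.ne h)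

theorem irreducible_X_sub_X [IsDomain R] {i j : σ} (h : i ≠ j) :
    Irreducible (X i - X j : MvPolynomial σ R) := by
  classical
  have hom : (X i - X j : MvPolynomial σ R).IsHomogeneous 1 :=
    (isHomogeneous_X R i).sub (isHomogeneous_X R j)
  refine irreducible_of_totalDegree_eq_one (hom.totalDegree (X_sub_X_ne_zero h)) fun r hr => ?_
  have coeff_eq_one : coeff (Finsupp.single i 1) (X i - X j : MvPolynomial σ R) = 1 := by
    rw [coeff_sub, coeff_X, coeff_X, if_pos rfl,
      if_neg (by rwa [Finsupp.single_left_inj one_ne_zero, eq_comm]), sub_zero]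
  exact isUnit_of_dvd_one (coeff_eq_one ▸ hr (Finsupp.single i 1))

section

variable [Fintype σ] [DecidableEq σ]

/-- The alternating sum `∑ sgn(w) w(f)` over all permutations of the variables, as a map which is
linear over the symmetric polynomials. -/
def alternant : MvPolynomial σ R →ₗ[symmetricSubalgebra σ R] MvPolynomial σ R where
  toFun f := ∑ w : Equiv.Perm σ, (Equiv.Perm.sign w : ℤ) • rename w f
  map_add' f g := by simp only [map_add, smul_add, Finset.sum_add_distrib]
  map_smul' a f := by
    have rename_smul (w : Equiv.Perm σ) : rename w (a • f) = a • rename w f := by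
      rw [Subalgebra.smul_def, Subalgebra.smul_def, smul_eq_mul, map_mul, a.2 w, smul_eq_mul]
    simp only [rename_smul, Finset.smul_sum, smul_comm a, RingHom.id_apply]

theorem alternant_apply (f : MvPolynomial σ R) :
    alternant f = ∑ w : Equiv.Perm σ, (Equiv.Perm.sign w : ℤ) • rename w f := rfl

theorem rename_alternant (w : Equiv.Perm σ) (f : MvPolynomial σ R) :
    rename w (alternant f) = (Equiv.Perm.sign w : ℤ) • alternant f := by
  rw [alternant_apply, map_sum, Finset.smul_sum]
  refine Fintype.sum_equiv (Equiv.mulLeft w) _ _ fun v => ?_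
  rw [map_zsmul, rename_rename, Equiv.coe_mulLeft, map_mul, smul_smul, Units.val_mul, ← mul_assoc,
    ← Units.val_mul, Int.units_mul_self, Units.val_one, one_mul, Equiv.Perm.coe_mul]

theorem isHomogeneous_alternant {m : ℕ} {f : MvPolynomial σ R} (hf : f.IsHomogeneous m) :
    (alternant f).IsHomogeneous m :=
  IsHomogeneous.sum _ _ _ fun w _ => by
    rw [← Int.cast_smul_eq_zsmul R, smul_eq_C_mul]
    exact hf.rename_isHomogeneous.C_mul _

-- Modulo `X i - X j` the summands of `w` and `swap i j * w` cancel.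
theorem X_sub_X_dvd_alternant {i j : σ} (h : i ≠ j) (f : MvPolynomial σ R) :
    X i - X j ∣ alternant f := by
  rw [← Ideal.mem_span_singleton, ← Ideal.Quotient.eq_zero_iff_mem, alternant_apply, map_sum]
  refine Finset.sum_involution (fun w _ => Equiv.swap i j * w) (fun w _ => ?_) (fun w _ _ hw => ?_)
    (fun w _ => Finset.mem_univ _) (fun w _ => Equiv.swap_mul_self_mul i j w)
  · rw [← map_add, Ideal.Quotient.eq_zero_iff_mem, Ideal.mem_span_singleton, Equiv.Perm.sign_mul,
      Equiv.Perm.sign_swap h, Equiv.Perm.coe_mul, ← rename_rename, neg_one_mul, Units.val_neg,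
      neg_smul, ← sub_eq_add_neg, ← smul_sub, zsmul_eq_mul]
    exact (X_sub_X_dvd_sub_rename_swap i j _).mul_left _
  · exact h (Equiv.swap_eq_one_iff.1 (mul_eq_right.1 hw))

end

variable (R) in
/-- The staircase monomial `x_1^{n-1} x_2^{n-2} ⋯ x_n^0`. -/
def staircase (n : ℕ) : MvPolynomial (Fin n) R := ∏ i, X i ^ (i.rev : ℕ)

theorem isHomogeneous_staircase : (staircase R n).IsHomogeneous (∑ i : Fin n, (i.rev : ℕ)) :=
  IsHomogeneous.prod _ _ _ fun i _ => isHomogeneous_X_pow i _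

theorem alternant_staircase :
    alternant (staircase R n) = ∏ i, ∏ j ∈ Finset.Ioi i, (X i - X j) := by
  have h := Matrix.det_projVandermonde (1 : Fin n → MvPolynomial (Fin n) R) X
  simp only [Pi.one_apply, one_mul] at h
  rw [← h, Matrix.det_apply, alternant_apply]
  refine Finset.sum_congr rfl fun w _ => ?_
  simp only [staircase, map_prod, map_pow, rename_X, Matrix.projVandermonde_apply, Pi.one_apply,
    one_pow, one_mul]
  rfl

theorem alternant_staircase_ne_zero [IsDomain R] : alternant (staircase R n) ≠ 0 := by
  rw [alternant_staircase]
  exact Finset.prod_ne_zero_iff.2 fun i _ => Finset.prod_ne_zero_iff.2 fun j hj =>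
    X_sub_X_ne_zero (Finset.mem_Ioi.1 hj).ne

theorem isRelPrime_X_sub_X [IsDomain R] {i j k l : Fin n} (hij : i < j) (hkl : k < l)
    (hne : (i, j) ≠ (k, l)) : IsRelPrime (X i - X j : MvPolynomial (Fin n) R) (X k - X l) := by
  refine (irreducible_X_sub_X hij.ne).isRelPrime_iff_not_dvd.2 fun hdvd => hne ?_
  have h := map_dvd (rename (R := R) fun m => if m = j then i else m) hdvd
  rw [map_sub, map_sub, rename_X, rename_X, rename_X, rename_X, if_pos rfl, if_neg hij.ne,
    sub_self, zero_dvd_iff, sub_eq_zero] at h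
  have := X_injective h
  grind

theorem alternant_staircase_dvd_alternant [IsDomain R] [UniqueFactorizationMonoid R]
    (f : MvPolynomial (Fin n) R) : alternant (staircase R n) ∣ alternant f := by
  rw [alternant_staircase, Finset.prod_sigma']
  refine Finset.prod_dvd_of_isRelPrime ?_ ?_
  · rintro ⟨i, j⟩ hij ⟨k, l⟩ hkl hne
    simp only [Finset.coe_sigma, Set.mem_sigma_iff, Finset.mem_coe, Finset.mem_univ,
      Finset.mem_Ioi, true_and] at hij hkl
    exact isRelPrime_X_sub_X hij hkl fun h => hne (by simpa using h)
  · rintro ⟨i, j⟩ hij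
    simp only [Finset.mem_sigma, Finset.mem_univ, Finset.mem_Ioi, true_and] at hij
    exact X_sub_X_dvd_alternant hij.ne f

theorem isHomogeneous_of_mul_left [IsDomain R] {f g : MvPolynomial σ R} {d m : ℕ}
    (hf : f.IsHomogeneous d) (hf0 : f ≠ 0) (hfg : (f * g).IsHomogeneous (d + m)) :
    g.IsHomogeneous m := by
  let _ : GradedAlgebra (homogeneousSubmodule σ R) := gradedAlgebra
  have component_mul (k : ℕ) :
      homogeneousComponent (d + k) (f * g) = f * homogeneousComponent k g := by
    rw [← decomposition.decompose'_apply, ← decomposition.decompose'_apply]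
    exact DirectSum.coe_decompose_mul_add_of_left_mem (homogeneousSubmodule σ R) hf
  rw [← sum_homogeneousComponent g]
  refine IsHomogeneous.sum _ _ _ fun k _ => ?_
  by_cases hk : k = m
  · exact hk ▸ homogeneousComponent_isHomogeneous k g
  · have h := component_mul k
    rw [homogeneousComponent_of_mem hfg, if_neg (by omega)] at h
    rw [(mul_eq_zero.1 h.symm).resolve_left hf0]
    exact isHomogeneous_zero _ _ _

section Quotient

variable [IsDomain R] [UniqueFactorizationMonoid R]

theorem exists_alternant_eq_mul (f : MvPolynomial (Fin n) R) :
    ∃ q : symmetricSubalgebra (Fin n) R, alternant f = alternant (staircase R n) * q := by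
  obtain ⟨q, hq⟩ := alternant_staircase_dvd_alternant f
  refine ⟨⟨q, fun w => mul_left_cancel₀ alternant_staircase_ne_zero ?_⟩, hq⟩
  have h := rename_alternant w f
  rw [hq, map_mul, rename_alternant, smul_mul_assoc] at h
  rcases Int.units_eq_one_or (Equiv.Perm.sign w) with hw | hw <;> simpa [hw] using h

/-- The quotient of the alternant of `f` by the alternant of the staircase monomial, which is the
Vandermonde product `∏_{i < j} (x_i - x_j)`. -/
def alternantQuot :
    MvPolynomial (Fin n) R →ₗ[symmetricSubalgebra (Fin n) R] symmetricSubalgebra (Fin n) R where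
  toFun f := (exists_alternant_eq_mul f).choose
  map_add' f g := Subtype.ext <| mul_left_cancel₀ (alternant_staircase_ne_zero (R := R)) <| by
    rw [← (exists_alternant_eq_mul (f + g)).choose_spec, map_add, Subalgebra.coe_add, mul_add,
      ← (exists_alternant_eq_mul f).choose_spec, ← (exists_alternant_eq_mul g).choose_spec]
  map_smul' a f := Subtype.ext <| mul_left_cancel₀ (alternant_staircase_ne_zero (R := R)) <| by
    rw [← (exists_alternant_eq_mul (a • f)).choose_spec, map_smul, RingHom.id_apply, smul_eq_mul,
      Subalgebra.coe_mul, mul_left_comm, ← (exists_alternant_eq_mul f).choose_spec,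
      Subalgebra.smul_def, smul_eq_mul]

theorem alternant_eq_mul_alternantQuot (f : MvPolynomial (Fin n) R) :
    alternant f = alternant (staircase R n) * alternantQuot f :=
  (exists_alternant_eq_mul f).choose_spec

theorem alternantQuot_staircase : alternantQuot (staircase R n) = 1 :=
  Subtype.ext <| mul_left_cancel₀ alternant_staircase_ne_zero <| by
    rw [← alternant_eq_mul_alternantQuot, Subalgebra.coe_one, mul_one]

theorem isHomogeneous_alternantQuot {m : ℕ} {f : MvPolynomial (Fin n) R}
    (hf : f.IsHomogeneous (∑ i : Fin n, (i.rev : ℕ) + m)) :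
    (alternantQuot f : MvPolynomial (Fin n) R).IsHomogeneous m :=
  isHomogeneous_of_mul_left (isHomogeneous_alternant isHomogeneous_staircase)
    alternant_staircase_ne_zero
    (alternant_eq_mul_alternantQuot f ▸ isHomogeneous_alternant hf)

theorem alternantQuot_eq_zero {m : ℕ} {f : MvPolynomial (Fin n) R} (hf : f.IsHomogeneous m)
    (hm : m < ∑ i : Fin n, (i.rev : ℕ)) : alternantQuot f = 0 := by
  by_contra hne
  have hq : (alternantQuot f : MvPolynomial (Fin n) R) ≠ 0 := fun h => hne (Subtype.ext h)
  have hmul := alternant_eq_mul_alternantQuot f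
  have hdeg := congrArg totalDegree hmul
  rw [totalDegree_mul_of_isDomain alternant_staircase_ne_zero hq,
    (isHomogeneous_alternant isHomogeneous_staircase).totalDegree alternant_staircase_ne_zero,
    (isHomogeneous_alternant hf).totalDegree
      (hmul ▸ mul_ne_zero alternant_staircase_ne_zero hq)] at hdeg
  omega

end Quotient

end Alternant

section GrassmannianIntegral

variable {k : ℕ}

theorem flagDim_coweightTwo_add_three (k : ℕ) : flagDim (coweightTwo (k + 3)) = 2 * (k + 1) := by
  have := flagDim_coweightTwo (k + 3) (by omega)
  omega

theorem card_filter_coweightTwo_lt (i : Fin (k + 2)) :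
    (Finset.univ.filter fun j => coweightTwo (k + 2) j < coweightTwo (k + 2) i).card =
      if (i : ℕ) < 2 then k else 0 := by
  split_ifs with hi
  · have lt_iff (j : Fin (k + 2)) :
        coweightTwo (k + 2) j < coweightTwo (k + 2) i ↔ ¬ (j : ℕ) < 2 := by
      unfold coweightTwo
      split_ifs <;> simp_all
    have := Finset.card_filter_add_card_filter_not (s := (Finset.univ : Finset (Fin (k + 2))))
      (fun j : Fin (k + 2) => (j : ℕ) < 2)
    rw [Fin.card_filter_val_lt, Finset.card_univ, Fintype.card_fin] at this
    simp only [lt_iff]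
    omega
  · rw [Finset.card_eq_zero, Finset.filter_eq_empty_iff]
    intro j _
    unfold coweightTwo
    split_ifs <;> simp

theorem pointClass_coweightTwo (k : ℕ) :
    (pointClass K (coweightTwo (k + 2))).1 = (X 0 * X 1) ^ k := by
  simp only [pointClass, card_filter_coweightTwo_lt]
  simp [Fin.prod_univ_succ, ← mul_pow]

variable (K) in
/-- The monomial `x_1 · x_3^{n-3} x_4^{n-4} ⋯ x_n^0` for `n = k + 3`: the product of the staircase
monomials of the two factors of the Levi subgroup `GL_2 × GL_{n-2}`. -/
def leviStaircase (k : ℕ) : MvPolynomial (Fin (k + 3)) K :=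
  X 0 * ∏ i : Fin (k + 1), X i.succ.succ ^ (i.rev : ℕ)

theorem isHomogeneous_leviStaircase (k : ℕ) :
    (leviStaircase K k).IsHomogeneous (1 + ∑ i : Fin (k + 1), (i.rev : ℕ)) :=
  (isHomogeneous_X K _).mul (IsHomogeneous.prod _ _ _ fun _ _ => isHomogeneous_X_pow _ _)

theorem pointClass_mul_leviStaircase (k : ℕ) :
    (pointClass K (coweightTwo (k + 3))).1 * leviStaircase K k = staircase K (k + 3) := by
  rw [pointClass_coweightTwo, leviStaircase, staircase, Fin.prod_univ_succ (n := k + 2),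
    Fin.prod_univ_succ (n := k + 1)]
  simp only [Fin.val_rev, Fin.val_succ, Fin.val_zero, Fin.succ_zero_eq_one, Fin.val_one,
    Nat.reduceAdd, Nat.reduceSubDiff]
  ring

theorem flagDim_add_leviStaircase (k : ℕ) :
    flagDim (coweightTwo (k + 3)) + (1 + ∑ i : Fin (k + 1), (i.rev : ℕ)) =
      ∑ i : Fin (k + 3), (i.rev : ℕ) := by
  rw [flagDim_coweightTwo_add_three, Fin.sum_univ_succ (n := k + 2),
    Fin.sum_univ_succ (n := k + 1)]
  simp only [Fin.val_rev, Fin.val_succ, Fin.val_zero, Nat.reduceSubDiff]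
  omega

variable (K) in
/-- The fibre integral of the Grassmannian of planes in `(k + 3)`-space as a quotient of
alternants. -/
def alternantIntegral (k : ℕ) : RWμ K (coweightTwo (k + 3)) →ₗ[RW K (k + 3)] RW K (k + 3) :=
  alternantQuot ∘ₗ LinearMap.mulRight (RW K (k + 3)) (leviStaircase K k) ∘ₗ
    (RWμ K (coweightTwo (k + 3))).val.toLinearMap

theorem alternantIntegral_apply (f : RWμ K (coweightTwo (k + 3))) :
    alternantIntegral K k f = alternantQuot (f.1 * leviStaircase K k) := rfl

theorem isFibreIntegral_alternantIntegral (k : ℕ) :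
    IsFibreIntegral (coweightTwo (k + 3)) (alternantIntegral K k) where
  eq_zero_of_lt m f hf hm := by
    refine alternantQuot_eq_zero (hf.mul (isHomogeneous_leviStaircase k)) ?_
    rw [← flagDim_add_leviStaircase]
    omega
  isHomogeneous m f hf := isHomogeneous_alternantQuot <| by
    have h := hf.mul (isHomogeneous_leviStaircase k)
    rwa [add_assoc, flagDim_add_leviStaircase, add_comm m] at h
  point := by rw [alternantIntegral_apply, pointClass_mul_leviStaircase, alternantQuot_staircase]

end GrassmannianIntegral

section DividedDifference

variable {σ R : Type*} [CommRing R] [IsDomain R] [DecidableEq σ] {i j : σ}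

/-- The divided difference `f ↦ (f - s(f)) / (x_i - x_j)`, where `s` exchanges `x_i` and `x_j`. -/
def dividedDiff [Fintype σ] (h : i ≠ j) :
    MvPolynomial σ R →ₗ[symmetricSubalgebra σ R] MvPolynomial σ R where
  toFun f := (X_sub_X_dvd_sub_rename_swap i j f).choose
  map_add' f g := mul_left_cancel₀ (X_sub_X_ne_zero (R := R) h) <| by
    rw [mul_add, ← (X_sub_X_dvd_sub_rename_swap i j _).choose_spec,
      ← (X_sub_X_dvd_sub_rename_swap i j _).choose_spec,
      ← (X_sub_X_dvd_sub_rename_swap i j _).choose_spec, map_add]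
    ring
  map_smul' a f := mul_left_cancel₀ (X_sub_X_ne_zero (R := R) h) <| by
    rw [RingHom.id_apply, mul_smul_comm, ← (X_sub_X_dvd_sub_rename_swap i j _).choose_spec,
      ← (X_sub_X_dvd_sub_rename_swap i j _).choose_spec, Subalgebra.smul_def, smul_eq_mul,
      Subalgebra.smul_def, smul_eq_mul, map_mul, a.2, mul_sub]

variable [Fintype σ] (h : i ≠ j)

theorem X_sub_X_mul_dividedDiff (f : MvPolynomial σ R) :
    (X i - X j) * dividedDiff h f = f - rename (Equiv.swap i j) f :=
  (X_sub_X_dvd_sub_rename_swap i j f).choose_spec.symm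

theorem dividedDiff_X_mul {f : MvPolynomial σ R} (hf : rename (Equiv.swap i j) f = f) :
    dividedDiff h (X i * f) = f :=
  mul_left_cancel₀ (X_sub_X_ne_zero (R := R) h) <| by
    rw [X_sub_X_mul_dividedDiff, map_mul, rename_X, Equiv.swap_apply_left, hf, sub_mul]

theorem isHomogeneous_dividedDiff {m : ℕ} {f : MvPolynomial σ R} (hf : f.IsHomogeneous (1 + m)) :
    (dividedDiff h f).IsHomogeneous m :=
  isHomogeneous_of_mul_left ((isHomogeneous_X R i).sub (isHomogeneous_X R j)) (X_sub_X_ne_zero h) <|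
    X_sub_X_mul_dividedDiff h f ▸ hf.sub hf.rename_isHomogeneous

end DividedDifference

section SchurTwo

variable {k : ℕ}

theorem rename_dividedDiff_coweightTwo (a b : ℕ) (w : Equiv.Perm (Fin (k + 3)))
    (hw : ∀ i, coweightTwo (k + 3) (w i) = coweightTwo (k + 3) i) :
    rename w (dividedDiff (R := K) Fin.zero_ne_one (X 0 ^ a * X 1 ^ b)) =
      dividedDiff Fin.zero_ne_one (X 0 ^ a * X 1 ^ b) := by
  refine mul_left_cancel₀ (X_sub_X_ne_zero (R := K) Fin.zero_ne_one) ?_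
  have spec := X_sub_X_mul_dividedDiff (R := K) (σ := Fin (k + 3)) Fin.zero_ne_one
    (X 0 ^ a * X 1 ^ b)
  simp only [map_mul, map_pow, rename_X, Equiv.swap_apply_left, Equiv.swap_apply_right] at spec
  have rename_spec := congrArg (rename w) spec
  simp only [map_sub, map_mul, map_pow, rename_X] at rename_spec
  obtain ⟨w0, w1⟩ | ⟨w0, w1⟩ : (w 0 = 0 ∧ w 1 = 1) ∨ (w 0 = 1 ∧ w 1 = 0) :=
    perm_coweightTwo (k + 3) (by omega) w hw
  all_goals rw [w0, w1] at rename_spec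
  · rw [rename_spec, spec]
  · linear_combination -rename_spec - spec

variable (K k) in
/-- The quotient `(x_1^a x_2^b - x_2^a x_1^b) / (x_1 - x_2)`, which for `a > b` is the Schur
polynomial of the partition `(a - 1, b)` in the Chern roots of the tautological subbundle. -/
def schurTwo (a b : ℕ) : RWμ K (coweightTwo (k + 3)) :=
  ⟨dividedDiff Fin.zero_ne_one (X 0 ^ a * X 1 ^ b), rename_dividedDiff_coweightTwo a b⟩

theorem X_sub_X_mul_schurTwo (a b : ℕ) :
    (X 0 - X 1) * (schurTwo K k a b).1 = X 0 ^ a * X 1 ^ b - X 1 ^ a * X 0 ^ b := by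
  rw [schurTwo, X_sub_X_mul_dividedDiff]
  simp

theorem ext_X_sub_X_mul {f g : RWμ K (coweightTwo (k + 3))}
    (h : (X 0 - X 1) * f.1 = (X 0 - X 1) * g.1) : f = g :=
  Subtype.ext (mul_left_cancel₀ (X_sub_X_ne_zero Fin.zero_ne_one) h)

theorem schurTwo_swap (a b : ℕ) : schurTwo K k b a = -schurTwo K k a b := by
  refine ext_X_sub_X_mul ?_
  rw [X_sub_X_mul_schurTwo, NegMemClass.coe_neg, mul_neg, X_sub_X_mul_schurTwo]
  ring

theorem schurTwo_self (a : ℕ) : schurTwo K k a a = 0 := by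
  refine ext_X_sub_X_mul ?_
  rw [X_sub_X_mul_schurTwo, ZeroMemClass.coe_zero]
  ring

theorem isHomogeneous_schurTwo {a b m : ℕ} (h : a + b = 1 + m) :
    (schurTwo K k a b).1.IsHomogeneous m :=
  isHomogeneous_dividedDiff _ (h ▸ (isHomogeneous_X_pow _ a).mul (isHomogeneous_X_pow _ b))

theorem schurTwo_eq_pointClass :
    schurTwo K k (k + 2) (k + 1) = pointClass K (coweightTwo (k + 3)) := by
  refine ext_X_sub_X_mul ?_
  rw [X_sub_X_mul_schurTwo, pointClass_coweightTwo]
  ring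

end SchurTwo

section ElementarySymmetric

variable {A : Type*} [CommRing A]

theorem multiset_esymm_cons_succ (a : A) (s : Multiset A) (m : ℕ) :
    (a ::ₘ s).esymm (m + 1) = s.esymm (m + 1) + a * s.esymm m := by
  simp only [Multiset.esymm, Multiset.powersetCard_cons, Multiset.map_add, Multiset.sum_add,
    Multiset.map_map, Function.comp_def, Multiset.prod_cons, Multiset.sum_map_mul_left]

theorem multiset_esymm_eq_sum_esymm_cons (a : A) (s : Multiset A) (m : ℕ) :
    s.esymm m = ∑ p ∈ antidiagonal m, (-a) ^ p.1 * (a ::ₘ s).esymm p.2 := by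
  induction m with
  | zero => simp [Multiset.esymm]
  | succ m ih =>
    simp only [Finset.Nat.sum_antidiagonal_succ, pow_zero, one_mul, pow_succ', mul_assoc,
      ← Finset.mul_sum]
    rw [← ih, multiset_esymm_cons_succ]
    ring

theorem multiset_esymm_mem_of_add (S : Subring A) (s t : Multiset A) (hs : ∀ a ∈ s, a ∈ S)
    (h : ∀ m, (s + t).esymm m ∈ S) (m : ℕ) : t.esymm m ∈ S := by
  induction s using Multiset.induction_on generalizing m with
  | empty => simpa using h m
  | cons a s ih =>
    refine ih (fun b hb => hs b (Multiset.mem_cons_of_mem hb)) (fun l => ?_) m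
    rw [multiset_esymm_eq_sum_esymm_cons a]
    refine sum_mem fun p _ => mul_mem (pow_mem (neg_mem (hs a (Multiset.mem_cons_self a s))) _) ?_
    rw [← Multiset.cons_add]
    exact h _

end ElementarySymmetric

section PartiallySymmetric

variable {σ R : Type*} [CommRing R] {p : σ → Prop} [DecidablePred p]

variable (R p) in
/-- The polynomial ring in the variables `x_i` as an iterated polynomial ring: the `x_i` with `p i`
are adjoined to the polynomials in the remaining variables. -/
def subtypeSumEquiv :
    MvPolynomial {i // p i} (MvPolynomial {i // ¬p i} R) ≃ₐ[R] MvPolynomial σ R :=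
  (sumAlgEquiv R _ _).symm.trans (renameEquiv R (Equiv.sumCompl p))

theorem subtypeSumEquiv_X (i : {i // p i}) : subtypeSumEquiv R p (X i) = X i.1 := by
  simp [subtypeSumEquiv]

theorem subtypeSumEquiv_C (b : MvPolynomial {i // ¬p i} R) :
    subtypeSumEquiv R p (C b) = rename Subtype.val b := by
  suffices h : (subtypeSumEquiv R p).toAlgHom.comp (IsScalarTower.toAlgHom R _ _) =
      rename Subtype.val from DFunLike.congr_fun h b
  refine algHom_ext fun i => ?_
  simp [subtypeSumEquiv, MvPolynomial.algebraMap_eq]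

theorem subtypeSumEquiv_rename (w : Equiv.Perm {i // p i})
    (f : MvPolynomial {i // p i} (MvPolynomial {i // ¬p i} R)) :
    subtypeSumEquiv R p (rename w f) =
      rename (Equiv.Perm.ofSubtype w) (subtypeSumEquiv R p f) := by
  induction f using MvPolynomial.induction_on with
  | C b =>
    rw [rename_C, subtypeSumEquiv_C, rename_rename]
    congr 2
    funext i
    exact (Equiv.Perm.ofSubtype_apply_of_not_mem w i.2).symm
  | add f g hf hg => simp only [map_add, hf, hg]
  | mul_X f i hf =>
    simp only [map_mul, hf, rename_X, subtypeSumEquiv_X, Equiv.Perm.ofSubtype_apply_coe]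

theorem subtypeSumEquiv_esymm [Fintype σ] (m : ℕ) :
    subtypeSumEquiv R p (esymm _ _ m) =
      (Finset.univ.val.map (Subtype.restrict p (X (R := R)))).esymm m := by
  rw [Finset.esymm_map_val, esymm]
  simp only [map_sum, map_prod, subtypeSumEquiv_X, Subtype.restrict_apply]

theorem esymm_subtype_mem_adjoin [Fintype σ] (m : ℕ) :
    (Finset.univ.val.map (Subtype.restrict p (X (R := R)))).esymm m ∈
      Algebra.adjoin (symmetricSubalgebra σ R) (X '' {i | ¬p i}) := by
  refine multiset_esymm_mem_of_add (Algebra.adjoin _ _).toSubring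
    (Finset.univ.val.map (Subtype.restrict (fun i => ¬p i) X)) _ ?_ (fun l => ?_) m
  · rintro _ hX
    obtain ⟨i, -, rfl⟩ := Multiset.mem_map.1 hX
    exact Algebra.subset_adjoin ⟨i.1, i.2, rfl⟩
  · rw [Finset.univ_val_map_subtype_restrict, Finset.univ_val_map_subtype_restrict,
      ← Multiset.map_add, add_comm, Finset.filter_val, Finset.filter_val, Multiset.filter_add_not,
      ← esymm_eq_multiset_esymm]
    exact Subalgebra.algebraMap_mem _ (⟨_, esymm_isSymmetric σ R l⟩ : symmetricSubalgebra σ R)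

theorem subtypeSumEquiv_C_mem_adjoin (b : MvPolynomial {i // ¬p i} R) :
    subtypeSumEquiv R p (C b) ∈ Algebra.adjoin (symmetricSubalgebra σ R) (X '' {i | ¬p i}) := by
  rw [subtypeSumEquiv_C]
  induction b using MvPolynomial.induction_on with
  | C r =>
    rw [rename_C]
    exact Subalgebra.algebraMap_mem _ (algebraMap R (symmetricSubalgebra σ R) r)
  | add b c hb hc => exact map_add (rename Subtype.val) b c ▸ add_mem hb hc
  | mul_X b i hb =>
    rw [map_mul, rename_X]
    exact mul_mem hb (Algebra.subset_adjoin ⟨i.1, i.2, rfl⟩)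

theorem mem_adjoin_X_of_rename_ofSubtype [Finite σ] {f : MvPolynomial σ R}
    (hf : ∀ w : Equiv.Perm {i // p i}, rename (Equiv.Perm.ofSubtype w) f = f) :
    f ∈ Algebra.adjoin (symmetricSubalgebra σ R) (X '' {i | ¬p i}) := by
  cases nonempty_fintype σ
  obtain ⟨f, rfl⟩ := (subtypeSumEquiv R p).surjective f
  have symm_f : f.IsSymmetric := fun w => (subtypeSumEquiv R p).injective <| by
    rw [subtypeSumEquiv_rename, hf]
  obtain ⟨g, hg⟩ := esymmAlgHom_surjective _ le_rfl
    (⟨f, symm_f⟩ : symmetricSubalgebra _ (MvPolynomial {i // ¬p i} R))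
  obtain rfl : _ = f := congrArg Subtype.val hg
  clear hg hf symm_f
  rw [esymmAlgHom_apply]
  induction g using MvPolynomial.induction_on with
  | C b =>
    rw [aeval_C]
    exact subtypeSumEquiv_C_mem_adjoin b
  | add g h hg hh => simpa only [map_add] using add_mem hg hh
  | mul_X g i hg =>
    rw [map_mul, map_mul, aeval_X, subtypeSumEquiv_esymm]
    exact mul_mem hg (esymm_subtype_mem_adjoin _)

end PartiallySymmetric

section Generation

variable {k : ℕ}

theorem coweightTwo_ofSubtype (w : Equiv.Perm {i : Fin n // 2 ≤ (i : ℕ)}) (i : Fin n) :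
    coweightTwo n (Equiv.Perm.ofSubtype w i) = coweightTwo n i := by
  by_cases hi : 2 ≤ (i : ℕ)
  · have hwi : 2 ≤ (Equiv.Perm.ofSubtype w i : ℕ) := by
      rw [Equiv.Perm.ofSubtype_apply_of_mem w hi]
      exact (w ⟨i, hi⟩).2
    rw [coweightTwo, coweightTwo, if_neg hi.not_gt, if_neg hwi.not_gt]
  · rw [Equiv.Perm.ofSubtype_apply_of_not_mem w hi]

theorem coweightTwo_swap_zero_one (i : Fin (k + 3)) :
    coweightTwo (k + 3) (Equiv.swap 0 1 i) = coweightTwo (k + 3) i := by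
  rw [Equiv.swap_apply_def]
  split_ifs with h0 h1 <;> simp [coweightTwo, *]

theorem image_X_not_two_le :
    X '' {i : Fin (k + 3) | ¬2 ≤ (i : ℕ)} = {(X 0 : MvPolynomial _ K), X 1} := by
  have not_two_le : {i : Fin (k + 3) | ¬2 ≤ (i : ℕ)} = {0, 1} := by
    ext i
    simp only [Set.mem_ofPred_eq, Set.mem_insert_iff, Set.mem_singleton_iff, Fin.ext_iff,
      Fin.val_zero, Fin.val_one]
    omega
  rw [not_two_le, Set.image_pair]

theorem mem_span_X_pow_mul_X_pow {f : MvPolynomial (Fin (k + 3)) K}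
    (hf : ∀ w : Equiv.Perm {i : Fin (k + 3) // 2 ≤ (i : ℕ)},
      rename (Equiv.Perm.ofSubtype w) f = f) :
    f ∈ Submodule.span (RW K (k + 3)) (Set.range fun p : ℕ × ℕ => X 0 ^ p.1 * X 1 ^ p.2) := by
  have hf' := mem_adjoin_X_of_rename_ofSubtype hf
  rw [image_X_not_two_le, ← Subalgebra.mem_toSubmodule, Algebra.adjoin_eq_span] at hf'
  refine Submodule.span_mono ?_ hf'
  rintro g hg
  obtain ⟨a, b, rfl⟩ := (Submonoid.mem_closure_pair _ _ _).1 hg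
  exact ⟨(a, b), rfl⟩

theorem span_range_schurTwo :
    Submodule.span (RW K (k + 3)) (Set.range fun p : ℕ × ℕ => schurTwo K k p.1 p.2) = ⊤ := by
  refine eq_top_iff.2 fun f _ => ?_
  have X_mul_f_mem := mem_span_X_pow_mul_X_pow (f := X 0 * f.1) fun w => by
    rw [map_mul, rename_X, f.2 _ (coweightTwo_ofSubtype w),
      Equiv.Perm.ofSubtype_apply_of_not_mem w (by simp)]
  have f_eq : dividedDiff Fin.zero_ne_one (X 0 * f.1) = f.1 :=
    dividedDiff_X_mul _ (f.2 _ coweightTwo_swap_zero_one)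
  have f_mem := Submodule.mem_map_of_mem (f := dividedDiff Fin.zero_ne_one) X_mul_f_mem
  rw [f_eq, Submodule.map_span, ← Set.range_comp] at f_mem
  obtain ⟨g, hg, hgf⟩ : f.1 ∈ Submodule.map (RWμ K (coweightTwo (k + 3))).val.toLinearMap
      (Submodule.span _ (Set.range fun p : ℕ × ℕ => schurTwo K k p.1 p.2)) := by
    rwa [Submodule.map_span, ← Set.range_comp]
  obtain rfl : g = f := Subtype.ext hgf
  exact hg

end Generation

section CompleteSymmetric

theorem X_cons_map_X_erase {σ R : Type*} [Fintype σ] [DecidableEq σ] [CommSemiring R] (i : σ) :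
    X i ::ₘ (Finset.univ.erase i).val.map (X (R := R)) = Finset.univ.val.map X := by
  rw [Finset.erase_val, ← Multiset.map_cons, Multiset.cons_erase (Finset.mem_univ i)]

theorem sum_neg_X_pow_mul_esymm {σ R : Type*} [Fintype σ] [CommRing R] (i : σ) :
    ∑ p ∈ antidiagonal (Fintype.card σ), (-X i) ^ p.1 * esymm σ R p.2 = 0 := by
  classical
  have card_lt : Multiset.card ((Finset.univ.erase i).val.map (X (R := R))) < Fintype.card σ := by
    rw [Multiset.card_map]
    exact Finset.card_erase_lt_of_mem (Finset.mem_univ i)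
  simp only [esymm_eq_multiset_esymm]
  rw [← X_cons_map_X_erase i, ← multiset_esymm_eq_sum_esymm_cons, Multiset.esymm,
    Multiset.powersetCard_eq_empty _ card_lt, Multiset.map_zero, Multiset.sum_zero]

variable (K n) in
/-- The elementary symmetric polynomial `e_j` as an element of `R^W`. -/
def esymmRW (j : ℕ) : RW K n :=
  ⟨esymm (Fin n) K j, esymm_isSymmetric _ _ _⟩

theorem esymmRW_zero : esymmRW K n 0 = 1 :=
  Subtype.ext (MvPolynomial.esymm_zero (Fin n) K)

theorem sum_esymmRW_smul_X_pow (i : Fin n) (m : ℕ) :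
    ∑ p ∈ antidiagonal n, ((-1) ^ p.1 * esymmRW K n p.1) •
      (X i : MvPolynomial (Fin n) K) ^ (m + p.2) = 0 := by
  have h := sum_neg_X_pow_mul_esymm (R := K) i
  rw [Fintype.card_fin, ← Finset.Nat.sum_antidiagonal_swap] at h
  rw [← mul_zero ((-1) ^ n * (X i) ^ m), ← h, Finset.mul_sum]
  refine Finset.sum_congr rfl fun p hp => ?_
  have neg_one_pow_n : (-1 : MvPolynomial (Fin n) K) ^ n = (-1) ^ p.1 * (-1) ^ p.2 := by
    rw [← pow_add, Finset.HasAntidiagonal.mem_antidiagonal.1 hp]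
  rw [neg_one_pow_n, Subalgebra.smul_def, smul_eq_mul]
  simp only [esymmRW, Prod.fst_swap, Prod.snd_swap, MulMemClass.coe_mul, SubmonoidClass.coe_pow,
    NegMemClass.coe_neg, OneMemClass.coe_one]
  have sq_neg_one_pow : (-1 : MvPolynomial (Fin n) K) ^ p.2 * (-1) ^ p.2 = 1 := by
    rw [← mul_pow, neg_one_mul, neg_neg, one_pow]
  rw [neg_pow (X i : MvPolynomial (Fin n) K), pow_add]
  linear_combination (-(-1) ^ p.1 * esymm (Fin n) K p.1 * X i ^ m * X i ^ p.2) * sq_neg_one_pow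

variable (K n) in
/-- The linear recurrence with characteristic polynomial `∏ (t - x_i)`. -/
def esymmRecurrence : LinearRecurrence (RW K n) where
  order := n
  coeffs j := -((-1) ^ (n - j : ℕ) * esymmRW K n (n - j))

theorem isSolution_esymmRecurrence_iff {u : ℕ → RW K n} :
    (esymmRecurrence K n).IsSolution u ↔
      ∀ m, ∑ p ∈ antidiagonal n, ((-1) ^ p.1 * esymmRW K n p.1) * u (m + p.2) = 0 := by
  refine forall_congr' fun m => ?_
  have sum_coeffs : ∑ j, (esymmRecurrence K n).coeffs j * u (m + j) =
      -1 * ∑ j : Fin n, ((-1) ^ (n - j : ℕ) * esymmRW K n (n - j)) * u (m + j) := by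
    rw [Finset.mul_sum]
    exact Finset.sum_congr rfl fun j _ => by simp only [esymmRecurrence]; ring
  change u (m + n) = _ ↔ _
  rw [sum_coeffs, ← Finset.Nat.sum_antidiagonal_swap,
    Finset.Nat.sum_antidiagonal_eq_sum_range_succ_mk, Finset.sum_range_succ, Finset.sum_range]
  simp only [Prod.fst_swap, Prod.snd_swap, Nat.sub_self, pow_zero, one_mul, esymmRW_zero]
  constructor <;> intro h <;> linear_combination h

variable (K n) in
/-- The solution of `esymmRecurrence` with initial values `0, …, 0, 1`: its value at `n - 1 + m` is
the complete homogeneous symmetric polynomial `h_m`, and `h_m = 0` for negative `m`. -/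
def shiftedHsymm : ℕ → RW K n :=
  (esymmRecurrence K n).mkSol fun j => if (j : ℕ) + 1 = n then 1 else 0

theorem isSolution_shiftedHsymm : (esymmRecurrence K n).IsSolution (shiftedHsymm K n) :=
  (esymmRecurrence K n).is_sol_mkSol _

theorem shiftedHsymm_of_lt {m : ℕ} (hm : m < n) :
    shiftedHsymm K n m = if m + 1 = n then 1 else 0 :=
  (esymmRecurrence K n).mkSol_eq_init (fun j => if (j : ℕ) + 1 = n then 1 else 0) ⟨m, hm⟩

end CompleteSymmetric

section LinearRecurrence

variable {R : Type*} [CommRing R] {E : LinearRecurrence R}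

theorem isSolution_comp_add_right {u : ℕ → R} (hu : E.IsSolution u) (l : ℕ) :
    E.IsSolution fun m => u (m + l) := fun m => by
  simpa only [add_right_comm] using hu (m + l)

theorem eq_zero_of_isSolution_of_alternating {w : ℕ → ℕ → R}
    (hw : ∀ b, E.IsSolution fun a => w a b) (w_self : ∀ a, w a a = 0)
    (w_swap : ∀ a b, w b a = -w a b) (w_init : ∀ a b, b < a → a < E.order → w a b = 0) :
    ∀ a b, w a b = 0 := by
  have ext_zero (b : ℕ) (h : ∀ a < E.order, w a b = 0) (a : ℕ) : w a b = 0 :=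
    congrFun ((E.eq_iff_eqOn_range_order _ 0 (hw b) E.solSpace.zero_mem).2 fun a ha =>
      h a (by simpa using ha)) a
  refine fun a b => ext_zero b (fun a ha => ?_) a
  rw [w_swap, ext_zero a (fun b hb => ?_) b, neg_zero]
  rcases lt_trichotomy a b with hab | rfl | hba
  · exact w_init b a hab hb
  · exact w_self a
  · rw [w_swap, w_init a b hba ha, neg_zero]

end LinearRecurrence

section FibreIntegral

variable {k : ℕ}

theorem sum_esymmRW_smul_schurTwo (m b : ℕ) :
    ∑ p ∈ antidiagonal (k + 3), ((-1) ^ p.1 * esymmRW K (k + 3) p.1) •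
      schurTwo K k (m + p.2) b = 0 := by
  refine Subtype.ext ?_
  simp only [AddSubmonoidClass.coe_finsetSum, SetLike.val_smul, schurTwo, ← map_smul, ← map_sum,
    ← smul_mul_assoc, ← Finset.sum_mul]
  rw [sum_esymmRW_smul_X_pow, zero_mul, map_zero, ZeroMemClass.coe_zero]

variable {I : RWμ K (coweightTwo (k + 3)) →ₗ[RW K (k + 3)] RW K (k + 3)}

theorem isSolution_map_schurTwo (b : ℕ) :
    (esymmRecurrence K (k + 3)).IsSolution fun a => I (schurTwo K k a b) := by
  refine isSolution_esymmRecurrence_iff.2 fun m => ?_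
  rw [← map_zero I, ← sum_esymmRW_smul_schurTwo m b, map_sum]
  exact Finset.sum_congr rfl fun p _ => (map_smul I _ _).symm

theorem map_schurTwo_of_lt (hI : IsFibreIntegral (coweightTwo (k + 3)) I) {a b : ℕ} (hba : b < a)
    (ha : a < k + 3) : I (schurTwo K k a b) = if b = k + 1 then 1 else 0 := by
  split_ifs with hb
  · obtain rfl : a = k + 2 := by omega
    rw [hb, schurTwo_eq_pointClass, hI.point]
  · refine hI.eq_zero_of_lt (a + b - 1) _ (isHomogeneous_schurTwo (by omega)) ?_
    rw [flagDim_coweightTwo_add_three]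
    omega

theorem map_schurTwo (hI : IsFibreIntegral (coweightTwo (k + 3)) I) (a b : ℕ) :
    I (schurTwo K k a b) = shiftedHsymm K (k + 3) a * shiftedHsymm K (k + 3) (b + 1) -
      shiftedHsymm K (k + 3) b * shiftedHsymm K (k + 3) (a + 1) := by
  set H := shiftedHsymm K (k + 3) with H_def
  have isSolution_H : (esymmRecurrence K (k + 3)).IsSolution H := isSolution_shiftedHsymm
  refine sub_eq_zero.1 (eq_zero_of_isSolution_of_alternating (E := esymmRecurrence K (k + 3))
    (w := fun a b => I (schurTwo K k a b) - (H a * H (b + 1) - H b * H (a + 1)))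
    (fun b => ?_) (fun a => ?_) (fun a b => ?_) (fun a b hba ha => ?_) a b)
  · let S := (esymmRecurrence K (k + 3)).solSpace
    have minors : (fun a => H a * H (b + 1) - H b * H (a + 1)) ∈ S := by
      simp only [mul_comm (H _) (H (b + 1))]
      exact S.sub_mem (S.smul_mem _ isSolution_H)
        (S.smul_mem _ (isSolution_comp_add_right isSolution_H 1))
    have integrals : (fun a => I (schurTwo K k a b)) ∈ S := isSolution_map_schurTwo b
    exact S.sub_mem integrals minors
  · simp only [schurTwo_self, map_zero, sub_self]
  · have map_swap : I (schurTwo K k b a) = -I (schurTwo K k a b) := by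
      rw [schurTwo_swap]
      exact map_neg I _
    linear_combination map_swap
  · have ha' : a < k + 3 := ha
    simp only [map_schurTwo_of_lt hI hba ha, H_def, shiftedHsymm_of_lt ha',
      shiftedHsymm_of_lt (hba.trans ha'), shiftedHsymm_of_lt (n := k + 3) (m := b + 1) (by omega)]
    split_ifs <;> first | omega | simp

theorem existsUnique_isFibreIntegral (k : ℕ) :
    ∃! I : RWμ K (coweightTwo (k + 3)) →ₗ[RW K (k + 3)] RW K (k + 3),
      IsFibreIntegral (coweightTwo (k + 3)) I := by
  refine ⟨alternantIntegral K k, isFibreIntegral_alternantIntegral k, fun I hI => ?_⟩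
  refine LinearMap.ext_on_range span_range_schurTwo fun p => ?_
  rw [map_schurTwo hI, map_schurTwo (isFibreIntegral_alternantIntegral k)]

theorem isFibreIntegral_fibreIntegral :
    IsFibreIntegral (coweightTwo (k + 3)) (fibreIntegral (K := K) (coweightTwo (k + 3))) := by
  rw [fibreIntegral, dif_pos (existsUnique_isFibreIntegral k)]
  exact (existsUnique_isFibreIntegral k).choose_spec.1

end FibreIntegral

section GrossMotive

theorem isHomogeneous_esymm (σ R : Type*) [Fintype σ] [CommSemiring R] (j : ℕ) :
    (esymm σ R j).IsHomogeneous j :=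
  IsHomogeneous.sum _ _ _ fun s hs => by
    have prod_X := IsHomogeneous.prod s (fun i => (X i : MvPolynomial σ R)) (fun _ => 1)
      fun i _ => isHomogeneous_X R i
    rwa [Finset.sum_const, smul_eq_mul, mul_one, (Finset.mem_powersetCard.1 hs).2] at prod_X

theorem esymmRW_mem_augIdeal {j : ℕ} (hj : j ≠ 0) : esymmRW K n j ∈ augIdeal K n := by
  rw [mem_augIdeal, constantCoeff_eq]
  exact (isHomogeneous_esymm (Fin n) K j).coeff_eq_zero (by simpa using hj.symm)

variable (K n) in
/-- The class of `e_{d + 1}` in the Gross motive. -/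
def esymmClass (d : ℕ) : GrossMotive K n :=
  (augIdeal K n).toCotangent ⟨esymmRW K n (d + 1), esymmRW_mem_augIdeal d.succ_ne_zero⟩

variable (K n) in
/-- The presentation of `R^W` as the polynomial ring in `e_1, …, e_n`; the variable `X i` goes to
`e_{i + 1}`. -/
abbrev esymmEquiv : MvPolynomial (Fin n) K ≃ₐ[K] RW K n :=
  esymmAlgEquiv (Fin n) K (Fintype.card_fin n)

theorem esymmEquiv_symm_esymmRW (i : Fin n) : (esymmEquiv K n).symm (esymmRW K n (i + 1)) = X i :=
  esymmAlgEquiv_symm_apply _ (Fintype.card_fin n) i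

theorem esymmEquiv_X (i : Fin n) : esymmEquiv K n (X i) = esymmRW K n (i + 1) := by
  rw [← esymmEquiv_symm_esymmRW, AlgEquiv.apply_symm_apply]

theorem constantCoeff_esymmEquiv (p : MvPolynomial (Fin n) K) :
    constantCoeff (esymmEquiv K n p).1 = constantCoeff p := by
  refine hom_eq_hom ((constantCoeff.comp (RW K n).val.toRingHom).comp
    (esymmEquiv K n : MvPolynomial (Fin n) K →+* RW K n)) constantCoeff ?_ (fun i => ?_) p
  · ext c
    exact congrArg (constantCoeff ·.1) ((esymmEquiv K n).commutes c)
  · rw [constantCoeff_X]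
    change constantCoeff (esymmEquiv K n (X i)).1 = 0
    rw [esymmEquiv_X]
    exact esymmRW_mem_augIdeal (Nat.succ_ne_zero i)

theorem homogeneousComponent_esymmEquiv (d : ℕ) (p : MvPolynomial (Fin n) K) :
    homogeneousComponent d (esymmEquiv K n p).1 =
      (esymmEquiv K n (weightedHomogeneousComponent (fun i : Fin n => (i : ℕ) + 1) d p)).1 := by
  induction p using MvPolynomial.induction_on' with
  | add p q hp hq =>
    simp only [map_add, Subalgebra.coe_add, hp, hq]
  | monomial s a =>
    have homogeneous : (esymmEquiv K n (monomial s a)).1.IsHomogeneous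
        (Finsupp.weight (fun i : Fin n => (i : ℕ) + 1) s) := by
      rw [Finsupp.weight_apply, Finsupp.sum_fintype s _ (by simp)]
      change (esymmAlgHom (Fin n) K n (monomial s a)).1.IsHomogeneous _
      rw [esymmAlgHom_apply, aeval_monomial, Finsupp.prod_fintype s _ fun i => pow_zero _]
      simp only [smul_eq_mul, mul_comm (s _)]
      exact IsHomogeneous.C_mul
        (IsHomogeneous.prod _ _ _ fun i _ => (isHomogeneous_esymm _ _ _).pow _) a
    rw [homogeneousComponent_of_mem homogeneous,
      weightedHomogeneousComponent_of_mem (isWeightedHomogeneous_monomial _ s a rfl)]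
    split_ifs
    · rfl
    · rw [map_zero, ZeroMemClass.coe_zero]

theorem isWeightedHomogeneous_esymmEquiv_symm {d : ℕ} {f : RW K n} (hf : f.1.IsHomogeneous d) :
    IsWeightedHomogeneous (fun i : Fin n => (i : ℕ) + 1) ((esymmEquiv K n).symm f) d := by
  have symm_eq : weightedHomogeneousComponent (fun i : Fin n => (i : ℕ) + 1) d
      ((esymmEquiv K n).symm f) = (esymmEquiv K n).symm f := by
    refine (AlgEquiv.eq_symm_apply _).2 (Subtype.ext ?_)
    rw [← homogeneousComponent_esymmEquiv, AlgEquiv.apply_symm_apply,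
      homogeneousComponent_of_mem hf, if_pos rfl]
  rw [← symm_eq]
  exact weightedHomogeneousComponent_isWeightedHomogeneous d _

/-- The coefficient of `e_{i + 1}` in a symmetric polynomial, written as a polynomial in
`e_1, …, e_n`. -/
def esymmCoeff (i : Fin n) : RW K n →ₗ[K] K :=
  lcoeff K (Finsupp.single i 1) ∘ₗ (esymmEquiv K n).symm.toLinearMap

theorem esymmCoeff_esymmRW (i j : Fin n) :
    esymmCoeff i (esymmRW K n (j + 1)) = if i = j then 1 else 0 := by
  change coeff (Finsupp.single i 1) ((esymmEquiv K n).symm (esymmRW K n (j + 1))) = _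
  rw [esymmEquiv_symm_esymmRW, coeff_X]
  simp only [Finsupp.single_left_inj one_ne_zero, eq_comm]

theorem esymmCoeff_mul (i : Fin n) (f g : RW K n) :
    esymmCoeff i (f * g) =
      constantCoeff f.1 * esymmCoeff i g + constantCoeff g.1 * esymmCoeff i f := by
  have esymmCoeff_eq (f : RW K n) :
      esymmCoeff i f = constantCoeff (pderiv i ((esymmEquiv K n).symm f)) := by
    rw [constantCoeff_eq, coeff_pderiv, zero_add, Finsupp.zero_apply, Nat.cast_zero, zero_add,
      mul_one]
    rfl
  rw [← (esymmEquiv K n).apply_symm_apply f, ← (esymmEquiv K n).apply_symm_apply g, ← map_mul]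
  simp only [esymmCoeff_eq, constantCoeff_esymmEquiv, AlgEquiv.symm_apply_apply,
    Derivation.leibniz, smul_eq_mul, map_add, map_mul]

theorem esymmCoeff_of_isHomogeneous {i : Fin n} {d : ℕ} {f : RW K n} (hf : f.1.IsHomogeneous d)
    (hd : (i : ℕ) + 1 ≠ d) : esymmCoeff i f = 0 :=
  (isWeightedHomogeneous_esymmEquiv_symm hf).coeff_eq_zero _
    (by simpa [Finsupp.weight_single] using hd)

theorem mem_augIdeal_sq {f : RW K n} (h0 : f ∈ augIdeal K n) (h1 : ∀ i, esymmCoeff i f = 0) :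
    f ∈ augIdeal K n ^ 2 := by
  have symm_mem : (esymmEquiv K n).symm f ∈ idealOfVars (Fin n) K ^ 2 := by
    refine (mem_pow_idealOfVars_iff' 2 _).2 fun s hs => ?_
    rcases (show s.degree = 0 ∨ s.degree = 1 by omega) with hs | hs
    · rw [(Finsupp.degree_eq_zero_iff s).1 hs, ← constantCoeff_eq, ← constantCoeff_esymmEquiv,
        AlgEquiv.apply_symm_apply]
      exact h0
    · obtain ⟨i, rfl⟩ := (Finsupp.range_single_one (σ := Fin n)).ge hs
      exact h1 i
  have idealOfVars_le : idealOfVars (Fin n) K ≤ (augIdeal K n).comap (esymmEquiv K n) := by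
    rw [Ideal.span_le]
    rintro _ ⟨i, rfl⟩
    rw [SetLike.mem_coe, Ideal.mem_comap, esymmEquiv_X]
    exact esymmRW_mem_augIdeal (Nat.succ_ne_zero i)
  have apply_mem := Ideal.le_comap_pow (esymmEquiv K n) 2
    (Ideal.pow_right_mono idealOfVars_le 2 symm_mem)
  rwa [Ideal.mem_comap, AlgEquiv.apply_symm_apply] at apply_mem

/-- The functional on the Gross motive induced by `esymmCoeff i`. -/
def esymmCoord (i : Fin n) : GrossMotive K n →ₗ[K] K :=
  Ideal.Cotangent.lift (esymmCoeff i ∘ₗ (augIdeal K n).subtype.restrictScalars K) fun f g => by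
    change esymmCoeff i (f.1 * g.1) = 0
    rw [esymmCoeff_mul, (mem_augIdeal f.1).1 f.2, (mem_augIdeal g.1).1 g.2, zero_mul, zero_mul,
      add_zero]

theorem linearIndependent_esymmClass :
    LinearIndependent K fun i : Fin n => esymmClass K n i :=
  LinearIndependent.of_pairwise_dual_eq_zero_one _ esymmCoord
    (fun i j hij => (esymmCoeff_esymmRW i j).trans (if_neg hij))
    (fun i => (esymmCoeff_esymmRW i i).trans (if_pos rfl))

theorem toCotangent_eq_sum (f : augIdeal K n) :
    (augIdeal K n).toCotangent f = ∑ i, esymmCoeff i f.1 • esymmClass K n i := by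
  set g : augIdeal K n := ∑ i : Fin n, esymmCoeff i f.1 •
    ⟨esymmRW K n (i + 1), esymmRW_mem_augIdeal (Nat.succ_ne_zero i)⟩
  have coe_g : g.1 = ∑ i : Fin n, esymmCoeff i f.1 • esymmRW K n (i + 1) :=
    map_sum ((augIdeal K n).subtype.restrictScalars K) _ _
  have toCotangent_g :
      (augIdeal K n).toCotangent g = ∑ i : Fin n, esymmCoeff i f.1 • esymmClass K n i :=
    (map_sum ((augIdeal K n).toCotangent.restrictScalars K) _ _).trans
      (Finset.sum_congr rfl fun _ _ => map_smul ((augIdeal K n).toCotangent.restrictScalars K) _ _)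
  rw [← toCotangent_g]
  refine (augIdeal K n).toCotangent_eq.2 (mem_augIdeal_sq ((f - g).2) fun i => ?_)
  simp only [map_sub, coe_g, map_sum, map_smul, esymmCoeff_esymmRW, smul_eq_mul, mul_ite, mul_one,
    mul_zero, Finset.sum_ite_eq, Finset.mem_univ, if_true, sub_self]

theorem toCotangent_of_isHomogeneous {d : ℕ} (hd : d < n) {f : augIdeal K n}
    (hf : f.1.1.IsHomogeneous (d + 1)) :
    (augIdeal K n).toCotangent f = esymmCoeff ⟨d, hd⟩ f.1 • esymmClass K n d := by
  rw [toCotangent_eq_sum]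
  refine Fintype.sum_eq_single (⟨d, hd⟩ : Fin n) fun i hi => ?_
  rw [esymmCoeff_of_isHomogeneous hf, zero_smul]
  exact fun hid => hi (Fin.ext (Nat.succ_injective hid))

theorem grossPiece_succ {d : ℕ} (hd : d < n) :
    grossPiece K n (d + 1) = K ∙ esymmClass K n d := by
  refine le_antisymm ?_ ?_
  · rintro _ ⟨f, hf, rfl⟩
    exact Submodule.mem_span_singleton.2 ⟨_, (toCotangent_of_isHomogeneous hd hf).symm⟩
  · rw [Submodule.span_singleton_le_iff_mem]
    exact ⟨_, isHomogeneous_esymm (Fin n) K (d + 1), rfl⟩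

theorem finrank_grossPiece_succ {d : ℕ} (hd : d < n) :
    Module.finrank K (grossPiece K n (d + 1)) = 1 := by
  rw [grossPiece_succ hd]
  exact finrank_span_singleton (linearIndependent_esymmClass.ne_zero ⟨d, hd⟩)

theorem isInternal_grossPiece :
    DirectSum.IsInternal fun i : Finset.Icc 1 n => grossPiece K n (i : ℕ) := by
  let index (i : Finset.Icc 1 n) : Fin n :=
    ⟨i - 1, by have := Finset.mem_Icc.1 i.2; omega⟩
  have index_add_one (i : Finset.Icc 1 n) : (index i : ℕ) + 1 = i :=
    Nat.sub_add_cancel (Finset.mem_Icc.1 i.2).1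
  have grossPiece_eq (i : Finset.Icc 1 n) :
      grossPiece K n i = K ∙ esymmClass K n (index i) := by
    rw [← grossPiece_succ (index i).2, index_add_one]
  have index_injective : Function.Injective index := fun i j hij =>
    Subtype.ext (by rw [← index_add_one, hij, index_add_one])
  refine DirectSum.isInternal_submodule_of_iSupIndep_of_iSup_eq_top ?_ (eq_top_iff.2 fun v _ => ?_)
  · simp only [grossPiece_eq]
    exact (linearIndependent_esymmClass.comp index index_injective).iSupIndep_span_singleton
  · obtain ⟨f, rfl⟩ := (augIdeal K n).toCotangent_surjective v
    rw [toCotangent_eq_sum]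
    refine sum_mem fun i _ => Submodule.smul_mem _ _ ?_
    refine Submodule.mem_iSup_of_mem ⟨i + 1, Finset.mem_Icc.2 ⟨i.1.succ_pos, i.2⟩⟩ ?_
    rw [grossPiece_succ i.2]
    exact Submodule.mem_span_singleton_self _

end GrossMotive

section Derivation

theorem pderiv_esymm_succ {σ R : Type*} [Fintype σ] [CommRing R] (i : σ) (m : ℕ) :
    pderiv i (esymm σ R (m + 1)) = ∑ p ∈ antidiagonal m, (-X i) ^ p.1 * esymm σ R p.2 := by
  classical
  set s : Multiset (MvPolynomial σ R) := (Finset.univ.erase i).val.map X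
  have pderiv_X_of_mem : Set.EqOn (pderiv i) (0 : Derivation R (MvPolynomial σ R) _) {f | f ∈ s} :=
    fun f hf => by
      obtain ⟨j, hj, rfl⟩ := Multiset.mem_map.1 hf
      exact pderiv_X_of_ne (Finset.ne_of_mem_erase hj)
  have pderiv_esymm_s (l : ℕ) : pderiv i (s.esymm l) = 0 := by
    refine Derivation.eqOn_adjoin pderiv_X_of_mem (multiset_sum_mem _ fun f hf => ?_)
    obtain ⟨t, ht, rfl⟩ := Multiset.mem_map.1 hf
    exact multiset_prod_mem _ fun f hf =>
      Algebra.subset_adjoin (Multiset.subset_of_le (Multiset.mem_powersetCard.1 ht).1 hf)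
  simp only [esymm_eq_multiset_esymm]
  rw [← X_cons_map_X_erase i, ← multiset_esymm_eq_sum_esymm_cons, multiset_esymm_cons_succ,
    map_add, Derivation.leibniz, pderiv_esymm_s, pderiv_esymm_s, pderiv_X_self]
  simp only [smul_eq_mul, mul_zero, mul_one, zero_add]

variable {k : ℕ}

theorem pderivCoweight_coweightTwo :
    pderivCoweight (K := K) (coweightTwo (k + 3)) = pderiv 0 + pderiv 1 := by
  refine derivation_ext fun i => ?_
  simp only [pderivCoweight, mkDerivation_X, Derivation.add_apply, pderiv_X]
  obtain rfl | rfl | hi : i = 0 ∨ i = 1 ∨ 2 ≤ (i : ℕ) := by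
    simp only [Fin.ext_iff, Fin.val_zero, Fin.val_one]
    omega
  · simp [coweightTwo]
  · simp [coweightTwo]
  · have ne_zero : i ≠ 0 := by rintro rfl; simp at hi
    have ne_one : i ≠ 1 := by rintro rfl; simp at hi
    simp [coweightTwo, hi.not_gt, ne_zero, ne_one]

variable (K k) in
/-- The power sum `x_1^j + x_2^j` of the Chern roots of the tautological subbundle. -/
def psumTwo (j : ℕ) : RWμ K (coweightTwo (k + 3)) :=
  ⟨X 0 ^ j + X 1 ^ j, fun w hw => by
    obtain ⟨w0, w1⟩ | ⟨w0, w1⟩ : (w 0 = 0 ∧ w 1 = 1) ∨ (w 0 = 1 ∧ w 1 = 0) :=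
      perm_coweightTwo (k + 3) (by omega) w hw
    all_goals simp only [map_add, map_pow, rename_X, w0, w1]
    exact add_comm _ _⟩

theorem isHomogeneous_psumTwo (j : ℕ) : (psumTwo K k j).1.IsHomogeneous j :=
  (isHomogeneous_X_pow _ j).add (isHomogeneous_X_pow _ j)

theorem pderivRW_esymmRW_succ (d : ℕ) :
    pderivRW (coweightTwo (k + 3)) (esymmRW K (k + 3) (d + 1)) =
      ∑ p ∈ antidiagonal d, ((-1) ^ p.1 * esymmRW K (k + 3) p.2) • psumTwo K k p.1 := by
  refine Subtype.ext ?_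
  change pderivCoweight (coweightTwo (k + 3)) (esymm _ K (d + 1)) = _
  rw [pderivCoweight_coweightTwo, Derivation.add_apply, pderiv_esymm_succ, pderiv_esymm_succ,
    ← Finset.sum_add_distrib, AddSubmonoidClass.coe_finsetSum]
  refine Finset.sum_congr rfl fun p _ => ?_
  rw [SetLike.val_smul, Subalgebra.smul_def, smul_eq_mul]
  simp only [esymmRW, psumTwo, MulMemClass.coe_mul, SubmonoidClass.coe_pow, NegMemClass.coe_neg,
    OneMemClass.coe_one]
  rw [neg_pow (X 0 : MvPolynomial (Fin (k + 3)) K), neg_pow (X 1 : MvPolynomial (Fin (k + 3)) K)]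
  ring

theorem etaTwo_mul_psumTwo (d : ℕ) :
    etaTwo K (k + 3) (by omega) * psumTwo K k d = ∑ p ∈ antidiagonal (2 * k + 3),
      (2 * k + 3).choose p.1 •
        (schurTwo K k (p.1 + d + 1) p.2 + schurTwo K k (p.2 + 1) (p.1 + d)) := by
  refine ext_X_sub_X_mul ?_
  have coe_mul : (etaTwo K (k + 3) (by omega) * psumTwo K k d).1 =
    (X 0 + X 1) ^ (2 * k + 3) * X 0 ^ d + (X 1 + X 0) ^ (2 * k + 3) * X 1 ^ d := by
    rw [add_comm (X 1) (X 0), ← mul_add]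
    rfl
  rw [coe_mul, (Commute.all _ _).add_pow', (Commute.all _ _).add_pow', Finset.sum_mul,
    Finset.sum_mul, ← Finset.sum_add_distrib, AddSubmonoidClass.coe_finsetSum, Finset.mul_sum,
    Finset.mul_sum]
  refine Finset.sum_congr rfl fun p _ => ?_
  rw [AddSubmonoidClass.coe_nsmul, AddMemClass.coe_add]
  simp only [mul_smul_comm, smul_mul_assoc, ← smul_add]
  congr 1
  linear_combination -X_sub_X_mul_schurTwo (K := K) (p.1 + d + 1) p.2 -
    X_sub_X_mul_schurTwo (K := K) (p.2 + 1) (p.1 + d)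

theorem fibreIntegral_etaTwo_mul_psumTwo (d : ℕ) :
    fibreIntegral (coweightTwo (k + 3)) (etaTwo K (k + 3) (by omega) * psumTwo K k d) =
      ∑ p ∈ antidiagonal (2 * k + 3), (2 * k + 3).choose p.1 •
        (2 • (shiftedHsymm K (k + 3) (p.1 + d + 1) * shiftedHsymm K (k + 3) (p.2 + 1)) -
          shiftedHsymm K (k + 3) (p.1 + d + 2) * shiftedHsymm K (k + 3) p.2 -
          shiftedHsymm K (k + 3) (p.1 + d) * shiftedHsymm K (k + 3) (p.2 + 2)) := by
  rw [etaTwo_mul_psumTwo, map_sum]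
  refine Finset.sum_congr rfl fun p _ => ?_
  rw [map_nsmul, map_add, map_schurTwo isFibreIntegral_fibreIntegral,
    map_schurTwo isFibreIntegral_fibreIntegral]
  congr 1
  ring

end Derivation

section Coefficients

theorem constantCoeff_esymmRW (j : ℕ) :
    constantCoeff (esymmRW K n j).1 = if j = 0 then 1 else 0 := by
  split_ifs with hj
  · rw [hj, esymmRW_zero, OneMemClass.coe_one, map_one]
  · exact esymmRW_mem_augIdeal hj

theorem esymmCoeff_neg_one_pow_mul_esymmRW_mul (i : Fin n) (l j : ℕ) (f : RW K n) :
    esymmCoeff i ((-1) ^ l * esymmRW K n j * f) = (-1) ^ l *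
      ((if j = 0 then 1 else 0) * esymmCoeff i f +
        constantCoeff f.1 * esymmCoeff i (esymmRW K n j)) := by
  have eq_smul : (-1) ^ l * esymmRW K n j * f = ((-1) ^ l : K) • (esymmRW K n j * f) := by
    rw [Algebra.smul_def, map_pow, map_neg, map_one, mul_assoc]
  rw [eq_smul, map_smul, esymmCoeff_mul, constantCoeff_esymmRW, smul_eq_mul]

theorem constantCoeff_shiftedHsymm (m : ℕ) :
    constantCoeff (shiftedHsymm K n m).1 = if m + 1 = n then 1 else 0 := by
  rcases lt_or_ge m n with hm | hm
  · rw [shiftedHsymm_of_lt hm, apply_ite Subtype.val, apply_ite constantCoeff]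
    simp
  · obtain ⟨m, rfl⟩ := Nat.exists_eq_add_of_le' hm
    rw [if_neg (by omega)]
    have recurrence := congrArg (constantCoeff ·.1)
      (isSolution_esymmRecurrence_iff.1 (isSolution_shiftedHsymm (K := K) (n := n)) m)
    simp only [AddSubmonoidClass.coe_finsetSum, MulMemClass.coe_mul, map_sum, map_mul,
      constantCoeff_esymmRW] at recurrence
    rw [Finset.sum_eq_single (0, n)] at recurrence
    · simpa using recurrence
    · rintro ⟨a, b⟩ hp hne
      have := Finset.HasAntidiagonal.mem_antidiagonal.1 hp
      rw [if_neg (by rintro rfl; simp_all), mul_zero, zero_mul]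
    · simp

theorem esymmCoeff_shiftedHsymm_add (i : Fin n) {d : ℕ} (hd : d < n) :
    esymmCoeff i (shiftedHsymm K n (d + n)) = (-1) ^ d * esymmCoeff i (esymmRW K n (d + 1)) := by
  have recurrence := congrArg (esymmCoeff i)
    (isSolution_esymmRecurrence_iff.1 (isSolution_shiftedHsymm (K := K) (n := n)) d)
  simp only [map_sum, esymmCoeff_neg_one_pow_mul_esymmRW_mul, constantCoeff_shiftedHsymm,
    map_zero] at recurrence
  rw [Finset.sum_eq_add (0, n) (d + 1, n - (d + 1)) (by simp)] at recurrence
  · simp only [show d + (n - (d + 1)) + 1 = n by omega, show d + n + 1 ≠ n by omega,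
      d.succ_ne_zero, if_true, if_false] at recurrence
    linear_combination recurrence
  · rintro ⟨a, b⟩ hp ⟨hne_zero, hne_succ⟩
    have hab : a + b = n := Finset.HasAntidiagonal.mem_antidiagonal.1 hp
    simp only [ne_eq, Prod.mk.injEq] at hne_zero hne_succ
    rw [if_neg (by omega), if_neg (by omega), zero_mul, zero_mul, add_zero, mul_zero]
  · simp
  · exact fun h => (h (Finset.HasAntidiagonal.mem_antidiagonal.2 (by simp only; omega))).elim

theorem esymmCoeff_shiftedHsymm_mul (i : Fin n) {a b d : ℕ} (hd : d < n)
    (hab : a + b + 1 = 2 * n + d) :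
    esymmCoeff i (shiftedHsymm K n a * shiftedHsymm K n b) =
      ((if a + 1 = n then 1 else 0) + if b + 1 = n then 1 else 0) *
        ((-1) ^ d * esymmCoeff i (esymmRW K n (d + 1))) := by
  rw [esymmCoeff_mul, constantCoeff_shiftedHsymm, constantCoeff_shiftedHsymm,
    ← esymmCoeff_shiftedHsymm_add i hd, add_mul]
  congr 1
  · split_ifs with ha
    · rw [show b = d + n by omega]
    · simp only [zero_mul]
  · split_ifs with hb
    · rw [show a = d + n by omega]
    · simp only [zero_mul]

theorem esymmCoeff_nabla_esymmRW {k : ℕ} (i : Fin (k + 3)) (d : ℕ) :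
    esymmCoeff i (nabla (coweightTwo (k + 3)) (etaTwo K (k + 3) (by omega))
        (esymmRW K (k + 3) (d + 1))) =
      (-1) ^ d * esymmCoeff i (fibreIntegral (coweightTwo (k + 3))
        (etaTwo K (k + 3) (by omega) * psumTwo K k d)) := by
  have constantCoeff_eq_zero (j : ℕ) : constantCoeff (fibreIntegral (coweightTwo (k + 3))
      (etaTwo K (k + 3) (by omega) * psumTwo K k j)).1 = 0 :=
    fibreIntegral_constantCoeff _ _ _
      ((etaTwo_isHomogeneous (k + 3) (by omega)).mul (isHomogeneous_psumTwo j)) (by omega)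
  rw [nabla_apply, pderivRW_esymmRW_succ, Finset.mul_sum, map_sum, map_sum,
    Finset.sum_eq_single (d, 0)]
  · rw [mul_smul_comm, map_smul, smul_eq_mul, esymmCoeff_neg_one_pow_mul_esymmRW_mul,
      constantCoeff_eq_zero, if_pos rfl, one_mul, zero_mul, add_zero]
  · rintro ⟨a, b⟩ hp hne
    have hab : a + b = d := Finset.HasAntidiagonal.mem_antidiagonal.1 hp
    rw [mul_smul_comm, map_smul, smul_eq_mul, esymmCoeff_neg_one_pow_mul_esymmRW_mul,
      constantCoeff_eq_zero, if_neg (by rintro rfl; simp_all), zero_mul, zero_mul, add_zero,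
      mul_zero]
  · simp

end Coefficients

section Eigenweight

/-- The negative of the second difference of the sequence `l ↦ if l + 1 = n then 1 else 0`, which is
the sequence of constant terms of `shiftedHsymm`. -/
def negSecondDiff (n m : ℕ) : ℤ :=
  2 * (if m + 2 = n then 1 else 0) - (if m + 1 = n then 1 else 0) - if m + 3 = n then 1 else 0

theorem binom_natCast (N m : ℕ) : binom N m = N.choose m := by
  simp [binom]

theorem sum_choose_mul_ite (N c m : ℕ) :
    ∑ p ∈ antidiagonal N, (N.choose p.1 : ℚ) * (if p.1 + c = m then 1 else 0) =
      binom N (m - c) := by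
  rw [Finset.Nat.sum_antidiagonal_eq_sum_range_succ_mk, binom]
  simp only [mul_ite, mul_one, mul_zero]
  split_ifs with hcm
  · have index_eq (l : ℕ) : l + c = m ↔ ((m : ℤ) - c).toNat = l := by omega
    simp only [index_eq, Finset.sum_ite_eq, Finset.mem_range, ite_eq_left_iff]
    intro hN
    rw [Nat.choose_eq_zero_of_lt (by omega), Nat.cast_zero]
  · exact Finset.sum_eq_zero fun l _ => if_neg (by omega)

theorem sum_choose_mul_negSecondDiff (N n c : ℕ) :
    ∑ p ∈ antidiagonal N, (N.choose p.1 : ℚ) * negSecondDiff n (p.1 + c) =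
      2 * binom N (n - c - 2) - binom N (n - c - 1) - binom N (n - c - 3) := by
  simp only [negSecondDiff, add_assoc, Int.cast_sub, Int.cast_mul, Int.cast_ite, Int.cast_one,
    Int.cast_zero, Int.cast_ofNat, mul_sub, Finset.sum_sub_distrib, mul_left_comm _ (2 : ℚ),
    ← Finset.mul_sum, sum_choose_mul_ite, Nat.cast_add, Nat.cast_ofNat, Nat.cast_one]
  simp only [sub_sub]

theorem one_div_mul_choose_eq_sub (k : ℕ) :
    1 / ((k + 3 : ℕ) : ℚ) * (2 * k + 4).choose (k + 2) =
      2 * (2 * k + 3).choose (k + 1) - (2 * k + 3).choose (k + 2) - (2 * k + 3).choose k := by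
  have choose_symm : (2 * k + 3).choose (k + 2) = (2 * k + 3).choose (k + 1) :=
    Nat.choose_symm_of_eq_add (by omega)
  have absorption : ((2 * k + 3).choose (k + 1) : ℚ) * (k + 1) =
      (2 * k + 3).choose k * (k + 3) := by
    have h := Nat.choose_succ_right_eq (2 * k + 3) k
    rw [show 2 * k + 3 - k = k + 3 by omega] at h
    exact_mod_cast h
  rw [Nat.choose_succ_succ, choose_symm]
  push_cast
  field_simp
  linear_combination -absorption

/-- The integer by which `nablaBar` multiplies the class of `e_{d + 1}` for `n = k + 3`, in the form
in which it comes out of the binomial expansion of `η`. -/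
def eigenweightSum (k d : ℕ) : ℤ :=
  ∑ p ∈ antidiagonal (2 * k + 3), (2 * k + 3).choose p.1 *
    (negSecondDiff (k + 3) (p.1 + d) + negSecondDiff (k + 3) p.2)

theorem cast_eigenweightSum (k d : ℕ) :
    (eigenweightSum k d : ℚ) = eigenweightTwo (k + 3) (d + 1) := by
  have sum_snd : ∑ p ∈ antidiagonal (2 * k + 3),
      ((2 * k + 3).choose p.1 : ℚ) * negSecondDiff (k + 3) p.2 =
        2 * (2 * k + 3).choose (k + 1) - (2 * k + 3).choose (k + 2) - (2 * k + 3).choose k := by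
    rw [← Finset.Nat.sum_antidiagonal_swap, ← binom_natCast, ← binom_natCast, ← binom_natCast]
    refine (Finset.sum_congr rfl fun p hp => ?_).trans
      ((sum_choose_mul_negSecondDiff (2 * k + 3) (k + 3) 0).trans ?_)
    · rw [Prod.fst_swap, Prod.snd_swap, add_zero, Nat.choose_symm_of_eq_add]
      rw [← Finset.HasAntidiagonal.mem_antidiagonal.1 hp, add_comm]
    · push_cast
      ring_nf
  simp only [eigenweightSum, Int.cast_sum, Int.cast_mul, Int.cast_add, Int.cast_natCast, mul_add,
    Finset.sum_add_distrib]
  rw [sum_snd, sum_choose_mul_negSecondDiff, ← one_div_mul_choose_eq_sub, ← binom_natCast,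
    eigenweightTwo, show 2 * (k + 3) - 2 = 2 * k + 4 by omega,
    show 2 * (k + 3) - 3 = 2 * k + 3 by omega]
  push_cast
  ring_nf

theorem esymmCoeff_fibreIntegral_etaTwo_mul_psumTwo {k : ℕ} (i : Fin (k + 3)) {d : ℕ}
    (hd : d < k + 3) :
    esymmCoeff i (fibreIntegral (coweightTwo (k + 3))
        (etaTwo K (k + 3) (by omega) * psumTwo K k d)) =
      (-1) ^ d * (eigenweightSum k d * esymmCoeff i (esymmRW K (k + 3) (d + 1))) := by
  rw [fibreIntegral_etaTwo_mul_psumTwo, map_sum, eigenweightSum, Int.cast_sum, Finset.sum_mul,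
    Finset.mul_sum]
  refine Finset.sum_congr rfl fun p hp => ?_
  have hp : p.1 + p.2 = 2 * k + 3 := Finset.HasAntidiagonal.mem_antidiagonal.1 hp
  rw [map_nsmul, map_sub, map_sub, map_nsmul, esymmCoeff_shiftedHsymm_mul i hd (by omega),
    esymmCoeff_shiftedHsymm_mul i hd (by omega), esymmCoeff_shiftedHsymm_mul i hd (by omega)]
  simp only [negSecondDiff, nsmul_eq_mul]
  push_cast
  ring

theorem nablaBar_esymmClass {k d : ℕ} (hd : d < k + 3) :
    nablaBar (coweightTwo (k + 3)) (etaTwo K (k + 3) (by omega))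
        (etaTwo_isHomogeneous (k + 3) (by omega)) (esymmClass K (k + 3) d) =
      (eigenweightTwo (k + 3) (d + 1) : K) • esymmClass K (k + 3) d := by
  rw [← cast_eigenweightSum, Rat.cast_intCast]
  conv_rhs => rw [esymmClass]
  rw [esymmClass, nablaBar_toCotangent, toCotangent_eq_sum, toCotangent_eq_sum, Finset.smul_sum]
  refine Finset.sum_congr rfl fun i _ => ?_
  rw [esymmCoeff_nabla_esymmRW, esymmCoeff_fibreIntegral_etaTwo_mul_psumTwo i hd, ← mul_assoc,
    ← mul_pow, neg_one_mul, neg_neg, one_pow, one_mul, mul_smul]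

end Eigenweight

end GLEigenweight

end

theorem mainTheorem12_general {K : Type*} [Field K] (n : ℕ) (hn : 3 ≤ n) :
    (∃! I : RWμ K (coweightTwo n) →ₗ[RW K n] RW K n, IsFibreIntegral (coweightTwo n) I) ∧
    DirectSum.IsInternal (fun i : Finset.Icc 1 n => grossPiece K n (i : ℕ)) ∧
    ∀ i ∈ Finset.Icc 1 n,
      Module.finrank K (grossPiece K n i) = 1 ∧
      ∀ v ∈ grossPiece K n i,
        nablaBar (coweightTwo n) (etaTwo K n hn) (etaTwo_isHomogeneous n hn) v =
          (eigenweightTwo n i : K) • v := by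
  obtain ⟨k, rfl⟩ := Nat.exists_eq_add_of_le' hn
  refine ⟨existsUnique_isFibreIntegral k, isInternal_grossPiece, fun i hi => ?_⟩
  obtain ⟨one_le, le_n⟩ := Finset.mem_Icc.1 hi
  obtain ⟨d, rfl⟩ := Nat.exists_eq_add_of_le' one_le
  refine ⟨finrank_grossPiece_succ le_n, fun v hv => ?_⟩
  rw [grossPiece_succ le_n] at hv
  obtain ⟨c, rfl⟩ := Submodule.mem_span_singleton.1 hv
  rw [map_smul, nablaBar_esymmClass le_n, smul_comm]

theorem mainTheorem12 {K : Type*} [Field K] [CharZero K] (n : ℕ) (hn : 3 ≤ n) :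
    (∃! I : RWμ K (coweightTwo n) →ₗ[RW K n] RW K n, IsFibreIntegral (coweightTwo n) I) ∧
    DirectSum.IsInternal (fun i : Finset.Icc 1 n => grossPiece K n (i : ℕ)) ∧
    ∀ i ∈ Finset.Icc 1 n,
      Module.finrank K (grossPiece K n i) = 1 ∧
      ∀ v ∈ grossPiece K n i,
        nablaBar (coweightTwo n) (etaTwo K n hn) (etaTwo_isHomogeneous n hn) v =
          (eigenweightTwo n i : K) • v :=
  mainTheorem12_general n hn
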